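/- Let $\mathbb D$ be the open unit disk, $\mathbb T$ its boundary and $m$ the normalized Lebesgue measure on $\mathbb T$. Let $H^2$ be the Hilbert space of analytic functions $f(z)=\sum_{n\ge 0}c_nz^n$ on $\mathbb D$ with $\|f\|^2=\sum_{n\ge 0}|c_n|^2<\infty$, and $H^\infty$ the space of bounded analytic functions on $\mathbb D$. A symbol is an analytic map $\phi\colon\mathbb D\to\mathbb D$; its radial limits $\phi^*(\xi)=\lim_{r\to1^-}\phi(r\xi)$ exist for almost every $\xi\in\mathbb T$. For a function $w$ on $\mathbb D$, the weighted composition operator $M_wC_\phi$ is $f\mapsto w\,(f\circ\phi)$. For $0<p<\infty$, a bounded operator $T$ on $H^2$ belongs to the Schatten class $S_p$ if it is compact and $\sum_n s_n(T)^p<\infty$, where the singular numbers $s_n(T)$ are the eigenvalues of $|T|=\sqrt{T^*T}$, repeated according to multiplicity; $S_2$ is the class of Hilbert--Schmidt operators. For every symbol $\phi$ the following assertions are equivalent: 1. there is $w\in H^2$, $w\not\equiv0$, such that $M_wC_\phi$ is a bounded Hilbert--Schmidt operator on $H^2$; 2. there is $w\in H^\infty$, $w\not\equiv 0$, such that $M_wC_\phi\in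 S_p$ for all $p>0$; 3. there are $p\in(0,\infty)$ and $w\in H^\infty$, $w\not\equiv0$, such that $M_wC_\phi\in S_p$; 4. $\displaystyle\int_{\mathbb T}\log\frac1{1-|\phi^*|}\,dm<\infty$, where the integrand is $+\infty$ at the points where $|\phi^*|=1$. -/

import Mathlib

open Complex Complex.UnitDisc Filter Topology MeasureTheory
open scoped ENNReal ComplexConjugate

noncomputable section

namespace WeightedComposition

/-! ### Analytic functions on the disc and their radial limits -/

/-- The extension of a function on the open unit disc to all of `ℂ` (by `0` off the disc). -/
def toPlane (f : 𝔻 → ℂ) : ℂ → ℂ := Function.extend (fun z : 𝔻 => (z : ℂ)) f 0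

/-- `f : 𝔻 → ℂ` is analytic (holomorphic) on the open unit disc. -/
def IsAnalytic (f : 𝔻 → ℂ) : Prop := DifferentiableOn ℂ (toPlane f) (Metric.ball 0 1)

/-- A symbol is an analytic self-map of the open unit disc. -/
def IsSymbol (φ : 𝔻 → 𝔻) : Prop := IsAnalytic fun z => (φ z : ℂ)

/-- The radial limit `f*(ξ) = lim_{r → 1⁻} f(r ξ)` at a point `ξ` of the unit circle
(for bounded analytic `f` the limit exists for almost every `ξ`). -/
def radialLimit (f : 𝔻 → ℂ) (ξ : Circle) : ℂ :=
  limUnder (𝓝[<] (1 : ℝ)) fun r : ℝ => toPlane f ((r : ℂ) * (ξ : ℂ))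

/-- `∫_𝕋 log (1 / (1 - |φ*|)) dm ∈ [0, ∞]`, where `m` is the normalized Lebesgue measure of the
circle.  The integrand is `+∞` at the points where `|φ*| = 1`. -/
def logIntegral (φ : 𝔻 → 𝔻) : ℝ≥0∞ :=
  (ENNReal.ofReal (2 * Real.pi))⁻¹ * ∫⁻ t in Set.Ioc 0 (2 * Real.pi),
    (ENNReal.log
      (1 / ENNReal.ofReal (1 - ‖radialLimit (fun z => (φ z : ℂ)) (Circle.exp t)‖))).toENNReal

/-! ### The Hardy spaces -/

/-- `H^∞`: bounded analytic functions on the disc. -/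
def IsHardyInfty (w : 𝔻 → ℂ) : Prop := IsAnalytic w ∧ ∃ C : ℝ, ∀ z, ‖w z‖ ≤ C

/-- The Hardy space `H²`: the functions `f(z) = ∑ cₙ zⁿ` on the disc with
`‖f‖² = ∑ |cₙ|² < ∞`.  An element is stored as its sequence of Taylor coefficients; the function
on the disc is given by the coercion coming from the instance of `RKHS` below. -/
def HardyTwo : Type := lp (fun _ : ℕ => ℂ) 2

namespace HardyTwo

instance : NormedAddCommGroup HardyTwo :=
  inferInstanceAs (NormedAddCommGroup (lp (fun _ : ℕ => ℂ) 2))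
instance : InnerProductSpace ℂ HardyTwo :=
  inferInstanceAs (InnerProductSpace ℂ (lp (fun _ : ℕ => ℂ) 2))
instance : CompleteSpace HardyTwo := inferInstanceAs (CompleteSpace (lp (fun _ : ℕ => ℂ) 2))

/-- The isometry of `H²` onto `ℓ²` given by the Taylor coefficients. -/
def coeff : HardyTwo ≃ₗᵢ[ℂ] lp (fun _ : ℕ => ℂ) 2 := LinearIsometryEquiv.refl ℂ _

lemma memlp_pow (z : 𝔻) : Memℓp (fun n : ℕ => conj ((z : ℂ) ^ n)) 2 := by
  apply memℓp_gen
  have h : ‖(z : ℂ)‖ ^ 2 < 1 := z.sq_norm_lt_one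
  refine (summable_geometric_of_lt_one (by positivity) h).congr fun n => ?_
  simp [← pow_mul, mul_comm]

/-- Point evaluation at `z` as the inner product with `(conj zⁿ)ₙ`. -/
lemma hasSum_eval (f : HardyTwo) (z : 𝔻) :
    HasSum (fun n => coeff f n * (z : ℂ) ^ n)
      (inner ℂ (⟨_, memlp_pow z⟩ : lp (fun _ : ℕ => ℂ) 2) (coeff f)) := by
  simpa using lp.hasSum_inner (𝕜 := ℂ) (⟨_, memlp_pow z⟩ : lp (fun _ : ℕ => ℂ) 2) (coeff f)

/-- The value `f(z) = ∑ cₙ zⁿ`, as a continuous linear functional of `f ∈ H²`. -/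
def evalCLM (z : 𝔻) : HardyTwo →L[ℂ] ℂ where
  toFun f := ∑' n, coeff f n * (z : ℂ) ^ n
  map_add' f g := by
    rw [(hasSum_eval _ z).tsum_eq, (hasSum_eval _ z).tsum_eq, (hasSum_eval _ z).tsum_eq, map_add,
      inner_add_right]
  map_smul' a f := by
    rw [(hasSum_eval _ z).tsum_eq, (hasSum_eval _ z).tsum_eq, map_smul, inner_smul_right,
      RingHom.id_apply, smul_eq_mul]
  cont := by
    simp only [(hasSum_eval _ z).tsum_eq]
    fun_prop

lemma eval_injective :
    Function.Injective (ContinuousLinearMap.pi evalCLM : HardyTwo →L[ℂ] 𝔻 → ℂ) := by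
  rw [injective_iff_map_eq_zero]
  intro f hf
  have hsum : ∀ z : 𝔻, HasSum (fun n => coeff f n * (z : ℂ) ^ n) 0 := by
    intro z
    have h0 : ∑' n, coeff f n * (z : ℂ) ^ n = 0 := congrFun hf z
    have h1 := hasSum_eval f z
    rwa [← h1.tsum_eq, h0] at h1
  have hp : HasFPowerSeriesOnBall (fun _ : ℂ => (0 : ℂ))
      (FormalMultilinearSeries.ofScalars ℂ (fun n => coeff f n)) 0 1 := by
    refine ⟨?_, one_pos, ?_⟩
    · refine ENNReal.le_of_forall_nnreal_lt fun r hr => ?_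
      refine FormalMultilinearSeries.le_radius_of_tendsto _ (l := 0) ?_
      have hr' : ‖((r : ℝ) : ℂ)‖ < 1 := by simpa using hr
      have := (hsum (UnitDisc.mk _ hr')).summable.tendsto_atTop_zero.norm
      simpa [FormalMultilinearSeries.ofScalars_norm] using this
    · intro y hy
      have hy' : ‖y‖ < 1 := by
        rwa [Metric.mem_eball, edist_zero_right, ← ofReal_norm, ENNReal.ofReal_lt_one] at hy
      simpa [FormalMultilinearSeries.ofScalars_apply_eq, mul_comm] using hsum (UnitDisc.mk y hy')
  have hz := hp.hasFPowerSeriesAt.eq_zero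
  have : coeff f = 0 := by
    ext n
    have := congrArg (fun q => q n (fun _ => (1 : ℂ))) hz
    simpa [FormalMultilinearSeries.ofScalars] using this
  simpa using this

/-- `H²` as a Hilbert space of functions on the disc: `f z = ∑ cₙ zⁿ`. -/
instance : RKHS ℂ HardyTwo 𝔻 ℂ where
  coeCLM := ContinuousLinearMap.pi evalCLM
  coeCLM_injective := eval_injective

lemma apply_eq (f : HardyTwo) (z : 𝔻) : f z = ∑' n, coeff f n * (z : ℂ) ^ n := rfl

lemma norm_sq_eq (f : HardyTwo) : ‖f‖ ^ 2 = ∑' n, ‖coeff f n‖ ^ 2 := by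
  rw [← coeff.norm_map f]
  exact_mod_cast lp.norm_rpow_eq_tsum (p := 2) (by norm_num) (coeff f)

end HardyTwo

/-! ### Schatten classes and weighted composition operators -/

/-- The sum `∑ₙ sₙ(T)^p` over the nonzero singular numbers of a compact operator `T`, that is,
over the eigenvalues `μ > 0` of `|T| = √(T* T)`, each one counted with its multiplicity. -/
def singularSum {H : Type*} [NormedAddCommGroup H] [InnerProductSpace ℂ H] [CompleteSpace H]
    (p : ℝ) (T : H →L[ℂ] H) : ℝ≥0∞ :=
  ∑' μ : Set.Ioi (0 : ℝ),
    (Module.finrank ℂ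
      (Module.End.eigenspace (CFC.abs T : H →L[ℂ] H).toLinearMap ((μ : ℝ) : ℂ)) : ℝ≥0∞) *
      ENNReal.ofReal ((μ : ℝ) ^ p)

/-- The Schatten class `S_p`, `p > 0`: compact operators with `p`-summable singular numbers.
For `p = 2` it is the class of Hilbert-Schmidt operators. -/
def IsSchatten {H : Type*} [NormedAddCommGroup H] [InnerProductSpace ℂ H] [CompleteSpace H]
    (p : ℝ) (T : H →L[ℂ] H) : Prop :=
  IsCompactOperator T ∧ singularSum p T < ∞

/-- The bounded operator `T` on `H²` is the weighted composition operator
`M_w C_φ : f ↦ w · (f ∘ φ)`. -/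
def IsWeightedComp (w : 𝔻 → ℂ) (φ : 𝔻 → 𝔻) (T : HardyTwo →L[ℂ] HardyTwo) : Prop :=
  ∀ (f : HardyTwo) (z : 𝔻), T f z = w z * f (φ z)

/-- `M_w C_φ` is a bounded operator on `H²` belonging to the Schatten class `S_p`. -/
def WeightedCompMemSchatten (p : ℝ) (w : 𝔻 → ℂ) (φ : 𝔻 → 𝔻) : Prop :=
  ∃ T : HardyTwo →L[ℂ] HardyTwo, IsWeightedComp w φ T ∧ IsSchatten p T

end WeightedComposition

end

/-! Everything comes down to how small `w` can be made where `|φ|` is close to 1, measured against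
powers of `1 - |φ|`.

Sufficiency of the logarithmic condition. Put `u = log (1 / (1 - |φ*|))` on the circle. If `u` is
integrable, then so is `H ∘ u` for some `H` of superlinear growth (`exists_superlinear_majorant`).
Let `w` be the outer function with `|w| = exp (-P[H ∘ u])`, where `P` is the Poisson integral.
Subharmonicity gives `log (1 / (1 - |φ|)) ≤ P[u]`, and superlinearity gives `k P[u] ≤ P[H ∘ u] +
C_k`. Hence `|w| ≤ C_k (1 - |φ|)^k` for every `k` (`exists_outer`). Since `(1 - x)^k x^n =
O(n^(-k))`, the functions `w φ^n` decay faster than any power of `n`, and a minimax bound for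
singular numbers (`singularSum_le`) puts the operator in every Schatten class.

Necessity. If `T` is in `S_p`, only `O(δ^(-p))` of its singular numbers exceed `δ`. Optimising over
`δ` bounds the sum of `‖T z^n‖²` over `n < N` by a power of `N` below the first
(`IsSchatten.exists_sum_norm_sq_le`). As `|φ| ≤ 1`, this makes the means of `|w|² |φ|^(2n)` decay
like `n^(-γ)` for some `γ > 0`. The series `∑ |φ|^(2n) / n`, which is `log (1 / (1 - |φ|²))`, is
then compared pointwise with `∑ n^(γ/2 - 1) |w|² |φ|^(2n)`: the comparison fails only for `n <
|w|^(-4/γ)`, and those terms form a harmonic sum of size `log (1 / |w|)`. Jensen's formula bounds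
the means of `log |w|` from below, so the means of `log (1 / (1 - |φ|²))` stay bounded as the radius
tends to 1.

The existence of radial limits (Fatou) is derived from the almost everywhere differentiability of a
Lipschitz primitive along the circle. -/

namespace WeightedComposition
-- Fatou's theorem on radial limits
open Real (circleAverage)
open Metric

/-- The kernel representing `deriv h r` as an average of `h` over the unit circle. -/
noncomputable def derivKernel (r : ℝ) (z : ℂ) : ℂ :=
  z / (z - r) ^ 2 - z / (z - (r : ℂ)⁻¹) ^ 2

lemma sub_ne_zero_of_norm_eq_one {z w : ℂ} (hz : ‖z‖ = 1) (hw : ‖w‖ < 1) : z - w ≠ 0 := by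
  intro h
  rw [sub_eq_zero] at h
  rw [h] at hz
  exact hw.ne hz

/-- The Herglotz kernel is `2 ζ / (ζ - w) - 1`, so its average against `h` is `2 h(w) - h(0)`;
differentiating in `w` under the integral gives the formula. -/
lemma hasDerivAt_circleAverage_sq {h : ℂ → ℂ} (hh : DiffContOnCl ℂ h (ball 0 1)) {w : ℂ}
    (hw : w ∈ ball (0 : ℂ) 1) :
    deriv h w = circleAverage (fun z ↦ z / (z - w) ^ 2 * h z) 0 1 := by
  have hcont : ContinuousOn h (sphere 0 1) :=
    hh.2.mono (by rw [closure_ball _ one_ne_zero]; exact sphere_subset_closedBall)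
  have hci : CircleIntegrable h 0 1 := hcont.circleIntegrable zero_le_one
  have key : ∀ w ∈ ball (0 : ℂ) 1,
      circleAverage (fun ζ ↦ herglotzRieszKernel 0 w ζ • h ζ) 0 1 = 2 * h w - h 0 := by
    intro w hw
    have hw' : ‖w‖ < 1 := by simpa using hw
    have e1 : circleAverage (fun ζ ↦ (2 : ℂ) • ((ζ / (ζ - w)) • h ζ) - h ζ) 0 1
        = 2 * h w - h 0 := by
      rw [Real.circleAverage_fun_sub, Real.circleAverage_fun_smul]
      · have := DiffContOnCl.circleAverage_smul_div (R := 1) (c := 0) (w := w) (f := h)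
          (by simpa using hh) (by simpa using hw)
        have h2 := DiffContOnCl.circleAverage (R := 1) (c := 0) (f := h) (by simpa using hh)
        simp only [sub_zero] at this
        rw [this, h2, smul_eq_mul]
      · apply ContinuousOn.circleIntegrable zero_le_one
        refine ContinuousOn.fun_const_smul ?_ _
        refine ContinuousOn.fun_smul ?_ hcont
        apply ContinuousOn.div (by fun_prop) (by fun_prop)
        intro x hx
        exact sub_ne_zero_of_norm_eq_one (by simpa using hx) hw'
      · exact hci
    rw [← e1]
    apply Real.circleAverage_congr_sphere
    intro ζ hζ
    have := sub_ne_zero_of_norm_eq_one (z := ζ) (w := w) (by simpa using hζ) hw'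
    simp only [herglotzRieszKernel_def, sub_zero, smul_eq_mul]
    field_simp
    ring
  have h1 := hasDerivAt_circleAverage_herglotzRieszKernel_smul hci hw
  have h2 : HasDerivAt (fun w ↦ 2 * h w - h 0) (2 * deriv h w) w := by
    have := (hh.differentiableAt isOpen_ball hw).hasDerivAt
    simpa using (this.const_mul 2).sub_const (h 0)
  have h3 := h1.congr_of_eventuallyEq (f₁ := fun w ↦ 2 * h w - h 0)
    (by filter_upwards [isOpen_ball.mem_nhds hw] with x hx using (key x hx).symm)
  have h4 := h2.unique h3
  have h5 : circleAverage (fun ζ ↦ (2 * ζ / (ζ - w) ^ 2) • h ζ) 0 1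
      = 2 * circleAverage (fun z ↦ z / (z - w) ^ 2 * h z) 0 1 := by
    rw [← smul_eq_mul, ← Real.circleAverage_fun_smul]
    congr 1
    ext ζ
    simp only [smul_eq_mul]
    ring
  rw [h5] at h4
  exact mul_left_cancel₀ two_ne_zero h4

/-- The subtracted term has its pole at the reflected point `1/r`, outside the closed disc, and
vanishes at 0, so it contributes nothing to the average. Its role is to cancel the leading part of
the kernel on the circle. -/
lemma deriv_eq_circleAverage {h : ℂ → ℂ} (hh : DiffContOnCl ℂ h (ball 0 1)) {r : ℝ}
    (h0 : 0 < r) (h1 : r < 1) :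
    deriv h r = circleAverage (fun z ↦ derivKernel r z * h z) 0 1 := by
  have hr : ‖(r : ℂ)‖ < 1 := by simpa [abs_of_pos h0] using h1
  have hri : ∀ z ∈ closedBall (0 : ℂ) 1, z - (r : ℂ)⁻¹ ≠ 0 := by
    intro z hz h
    rw [sub_eq_zero] at h
    have : ‖z‖ ≤ 1 := by simpa using hz
    rw [h, norm_inv, norm_real, Real.norm_of_nonneg h0.le] at this
    have := one_lt_inv₀ h0 |>.2 h1
    linarith
  have hcont : ContinuousOn h (closedBall 0 1) := by
    have := hh.2
    rwa [closure_ball _ one_ne_zero] at this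
  have hzero : circleAverage (fun z ↦ z / (z - (r : ℂ)⁻¹) ^ 2 * h z) 0 1 = 0 := by
    have hd : DiffContOnCl ℂ (fun z ↦ z / (z - (r : ℂ)⁻¹) ^ 2) (ball 0 1) := by
      apply DifferentiableOn.diffContOnCl
      rw [closure_ball _ one_ne_zero]
      apply DifferentiableOn.div (by fun_prop) (by fun_prop)
      intro x hx
      exact pow_ne_zero _ (hri x hx)
    have := DiffContOnCl.circleAverage (R := 1) (c := 0)
      (f := fun z ↦ z / (z - (r : ℂ)⁻¹) ^ 2 * h z) (by simpa using hd.smul hh)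
    simpa using this
  rw [hasDerivAt_circleAverage_sq hh (by simpa using hr)]
  refine Eq.trans (b := circleAverage (fun z ↦ z / (z - r) ^ 2 * h z) 0 1
    - circleAverage (fun z ↦ z / (z - (r : ℂ)⁻¹) ^ 2 * h z) 0 1) (by rw [hzero, sub_zero]) ?_
  rw [← Real.circleAverage_fun_sub]
  · simp only [derivKernel, sub_mul]
  · apply ContinuousOn.circleIntegrable zero_le_one
    apply ContinuousOn.mul _ (hcont.mono sphere_subset_closedBall)
    apply ContinuousOn.div (by fun_prop) (by fun_prop)
    intro x hx
    exact pow_ne_zero _ (sub_ne_zero_of_norm_eq_one (by simpa using hx) hr)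
  · apply ContinuousOn.circleIntegrable zero_le_one
    apply ContinuousOn.mul _ (hcont.mono sphere_subset_closedBall)
    apply ContinuousOn.div (by fun_prop) (by fun_prop)
    intro x hx
    exact pow_ne_zero _ (hri x (sphere_subset_closedBall hx))

/-- On the unit circle `|z - 1/r| = |z - r| / r`. Writing the kernel as a difference of squares
extracts the factor `1 - r²`, leaving `2 (1 - r²) / |z - r|³`. The triangle inequality gives `|z -
1| ≤ 2 |z - r|`, which turns one power of the distance into the weight. -/
lemma norm_derivKernel_mul_le {r : ℝ} (h0 : 0 < r) (h1 : r < 1) {z : ℂ} (hz : ‖z‖ = 1) :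
    ‖derivKernel r z‖ * ‖z - 1‖ ≤ 4 * poissonKernel 0 r z := by
  have hr : ‖(r : ℂ)‖ < 1 := by simpa [abs_of_pos h0] using h1
  have hne := sub_ne_zero_of_norm_eq_one hz hr
  have hrc : (r : ℂ) ≠ 0 := by exact_mod_cast h0.ne'
  set d := ‖z - r‖ with hd
  have hdpos : 0 < d := norm_pos_iff.2 hne
  have hinv : ‖z - (r : ℂ)⁻¹‖ = d / r := by
    have e : z - (r : ℂ)⁻¹ = -(z * (conj z - r)) / r := by
      have : z * conj z = 1 := by rw [mul_conj, normSq_eq_norm_sq, hz]; simp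
      field_simp
      linear_combination this
    have e2 : ‖conj z - (r : ℂ)‖ = d := by
      rw [hd, ← Complex.norm_conj (z - r)]
      simp
    rw [e]
    simp [hz, e2, abs_of_pos h0]
  have hne' : z - (r : ℂ)⁻¹ ≠ 0 := by
    rw [← norm_pos_iff, hinv]; positivity
  have hK : derivKernel r z = z * ((r - (r : ℂ)⁻¹) * ((z - r) + (z - (r : ℂ)⁻¹)))
      / ((z - r) ^ 2 * (z - (r : ℂ)⁻¹) ^ 2) := by
    rw [derivKernel, div_sub_div _ _ (pow_ne_zero _ hne) (pow_ne_zero _ hne')]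
    congr 1
    ring
  have hrr : ‖(r : ℂ) - (r : ℂ)⁻¹‖ = (1 - r ^ 2) / r := by
    have : (r : ℂ) - (r : ℂ)⁻¹ = ((-((1 - r ^ 2) / r) : ℝ) : ℂ) := by
      push_cast
      field_simp
      ring
    rw [this, norm_real, norm_neg, Real.norm_of_nonneg]
    have : r ^ 2 < 1 := by nlinarith
    exact div_nonneg (by linarith) h0.le
  have hr2 : 0 ≤ 1 - r ^ 2 := by nlinarith
  have hn : ‖derivKernel r z‖ ≤ 2 * (1 - r ^ 2) / d ^ 3 := by
    rw [hK, norm_div, norm_mul, norm_mul, norm_mul, norm_pow, norm_pow, hz, hrr, hinv, ← hd,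
      one_mul]
    have hs : ‖(z - r) + (z - (r : ℂ)⁻¹)‖ ≤ 2 * d / r := by
      refine (norm_add_le _ _).trans ?_
      rw [hinv, ← hd]
      have : d ≤ d / r := le_div_self hdpos.le h0 h1.le
      have h2 : 2 * d / r = d / r + d / r := by ring
      linarith
    calc (1 - r ^ 2) / r * ‖(z - r) + (z - (r : ℂ)⁻¹)‖ / (d ^ 2 * (d / r) ^ 2)
        ≤ (1 - r ^ 2) / r * (2 * d / r) / (d ^ 2 * (d / r) ^ 2) := by gcongr
      _ = 2 * (1 - r ^ 2) / d ^ 3 := by field_simp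
  have h1z : ‖z - 1‖ ≤ 2 * d := by
    have e1 : ‖z - 1‖ ≤ d + (1 - r) := by
      have : z - 1 = (z - r) + ((r - 1 : ℝ) : ℂ) := by push_cast; ring
      rw [this]
      refine (norm_add_le _ _).trans ?_
      rw [norm_real, Real.norm_of_nonpos (by linarith)]
      linarith
    have e2 : 1 - r ≤ d := by
      have := norm_sub_norm_le z r
      rw [hz, norm_real, Real.norm_of_nonneg h0.le] at this
      exact this
    linarith
  have hP : poissonKernel 0 r z = (1 - r ^ 2) / d ^ 2 := by
    simp [poissonKernel_def, hz, hd]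
  rw [hP]
  calc ‖derivKernel r z‖ * ‖z - 1‖ ≤ 2 * (1 - r ^ 2) / d ^ 3 * (2 * d) := by gcongr
    _ = 4 * ((1 - r ^ 2) / d ^ 2) := by field_simp; ring

lemma circleAverage_poissonKernel {w : ℂ} (hw : w ∈ ball (0 : ℂ) 1) :
    circleAverage (poissonKernel 0 w) 0 1 = 1 := by
  have := DiffContOnCl.circleAverage_poissonKernel_smul (R := 1) (c := 0) (w := w)
    (f := fun _ : ℂ ↦ (1 : ℂ)) diffContOnCl_const hw
  have h2 := Complex.ofRealCLM.circleAverage_comp_comm (f := poissonKernel 0 w) (c := 0) (R := 1)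
    (by
      rw [poissonKernel_eq_re_herglotzRieszKernel]
      apply ContinuousOn.circleIntegrable zero_le_one
      have := continuousOn_herglotzRieszKernel_sphere (c := 0) (R := 1) hw
      rw [abs_one] at this
      exact continuous_re.comp_continuousOn this)
  have h3 : (⇑ofRealCLM ∘ poissonKernel 0 w) = poissonKernel 0 w • fun _ : ℂ ↦ (1 : ℂ) := by
    ext z; simp
  rw [h3, this] at h2
  simpa using h2.symm

lemma circleIntegrable_poissonKernel {w : ℂ} (hw : w ∈ ball (0 : ℂ) 1) :
    CircleIntegrable (poissonKernel 0 w) 0 1 := by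
  rw [poissonKernel_eq_re_herglotzRieszKernel]
  apply ContinuousOn.circleIntegrable zero_le_one
  have := continuousOn_herglotzRieszKernel_sphere (c := 0) (R := 1) hw
  rw [abs_one] at this
  exact continuous_re.comp_continuousOn this

lemma norm_circleAverage_le {f : ℂ → ℂ} {g : ℂ → ℝ} (hg : CircleIntegrable g 0 1)
    (h : ∀ z : ℂ, ‖z‖ = 1 → ‖f z‖ ≤ g z) :
    ‖circleAverage f 0 1‖ ≤ circleAverage g 0 1 := by
  rw [Real.circleAverage_def, Real.circleAverage_def, norm_smul, smul_eq_mul,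
    Real.norm_of_nonneg (by positivity)]
  gcongr
  apply intervalIntegral.norm_integral_le_of_norm_le Real.two_pi_pos.le _ hg
  filter_upwards with t _ using h _ (by simp)

/-- The kernel is at most four Poisson kernels divided by `|z - 1|`. Near 1 the little-o hypothesis
leaves `ε/2` times a Poisson kernel of mean 1; away from 1 the Poisson kernel itself is `O(1 - r²)`,
and the Lipschitz bound at 1 suffices. -/
theorem tendsto_deriv_of_isLittleO {h : ℂ → ℂ} (hh : DiffContOnCl ℂ h (ball 0 1)) {M : ℝ}
    (hM : ∀ z : ℂ, ‖z‖ = 1 → ‖h z‖ ≤ M * ‖z - 1‖)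
    (ho : ∀ ε > 0, ∀ᶠ z in 𝓝 (1 : ℂ), ‖z‖ = 1 → ‖h z‖ ≤ ε * ‖z - 1‖) :
    Tendsto (fun r : ℝ ↦ deriv h r) (𝓝[<] 1) (𝓝 0) := by
  have hM0 : 0 ≤ M := by
    have := (norm_nonneg _).trans (hM (-1) (by simp))
    have h2 : (0 : ℝ) < ‖(-1 : ℂ) - 1‖ := by norm_num
    exact nonneg_of_mul_nonneg_left this h2
  rw [Metric.tendsto_nhds]
  intro ε hε
  obtain ⟨δ, hδ, hnear⟩ := Metric.eventually_nhds_iff.1 (ho (ε / 8) (by positivity))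
  have ht : Tendsto (fun r : ℝ ↦ ε / 2 + 16 * M / δ ^ 2 * (1 - r ^ 2)) (𝓝[<] 1) (𝓝 (ε / 2)) := by
    have : Tendsto (fun r : ℝ ↦ ε / 2 + 16 * M / δ ^ 2 * (1 - r ^ 2)) (𝓝 1)
        (𝓝 (ε / 2 + 16 * M / δ ^ 2 * (1 - 1 ^ 2))) := by
      apply Continuous.tendsto
      fun_prop
    simp only [one_pow, sub_self, mul_zero, add_zero] at this
    exact this.mono_left nhdsWithin_le_nhds
  have e1 : ∀ᶠ r : ℝ in 𝓝[<] 1, r < 1 := eventually_mem_nhdsWithin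
  have e2 : ∀ᶠ r : ℝ in 𝓝[<] 1, max 0 (1 - δ / 2) < r :=
    eventually_nhdsWithin_of_eventually_nhds (lt_mem_nhds (by simp [hδ]))
  filter_upwards [e1, e2, ht.eventually_lt_const (half_lt_self hε)] with r hr1 hr2 hr3
  have hr0 : 0 < r := (le_max_left _ _).trans_lt hr2
  have hrδ : 1 - r < δ / 2 := by linarith [(le_max_right 0 (1 - δ / 2)).trans_lt hr2]
  have hrb : (r : ℂ) ∈ ball (0 : ℂ) 1 := by simpa [abs_of_pos hr0] using hr1
  rw [dist_zero_right, deriv_eq_circleAverage hh hr0 hr1]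
  have hr20 : 0 ≤ 1 - r ^ 2 := by nlinarith
  refine lt_of_le_of_lt (norm_circleAverage_le
    (g := fun z ↦ (ε / 2) • poissonKernel 0 r z + 16 * M / δ ^ 2 * (1 - r ^ 2)) ?_ ?_) ?_
  · exact ((circleIntegrable_poissonKernel hrb).const_smul).add (circleIntegrable_const _ _ _)
  · intro z hz
    have hP := norm_derivKernel_mul_le hr0 hr1 hz
    have hPeq : poissonKernel 0 r z = (1 - r ^ 2) / ‖z - r‖ ^ 2 := by
      simp [poissonKernel_def, hz]
    have hP0 : 0 ≤ poissonKernel 0 r z := by rw [hPeq]; positivity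
    rw [norm_mul, smul_eq_mul]
    by_cases hc : dist z 1 < δ
    · have := hnear hc hz
      have h3 : 0 ≤ 16 * M / δ ^ 2 * (1 - r ^ 2) := by positivity
      calc ‖derivKernel r z‖ * ‖h z‖ ≤ ‖derivKernel r z‖ * (ε / 8 * ‖z - 1‖) := by gcongr
        _ = ε / 8 * (‖derivKernel r z‖ * ‖z - 1‖) := by ring
        _ ≤ ε / 8 * (4 * poissonKernel 0 r z) := by gcongr
        _ = ε / 2 * poissonKernel 0 r z := by ring
        _ ≤ _ := by linarith
    · rw [not_lt, dist_eq_norm] at hc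
      have hfar : δ / 2 ≤ ‖z - r‖ := by
        have e1 : ‖z - 1‖ ≤ ‖z - r‖ + (1 - r) := by
          have : z - 1 = (z - r) + ((r - 1 : ℝ) : ℂ) := by push_cast; ring
          rw [this]
          refine (norm_add_le _ _).trans ?_
          rw [norm_real, Real.norm_of_nonpos (by linarith)]
          linarith
        linarith
      have h3 : 0 ≤ ε / 2 * poissonKernel 0 r z := by positivity
      calc ‖derivKernel r z‖ * ‖h z‖ ≤ ‖derivKernel r z‖ * (M * ‖z - 1‖) := by
            gcongr; exact hM z hz
        _ = M * (‖derivKernel r z‖ * ‖z - 1‖) := by ring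
        _ ≤ M * (4 * ((1 - r ^ 2) / ‖z - r‖ ^ 2)) := by rw [← hPeq]; gcongr
        _ ≤ M * (4 * ((1 - r ^ 2) / (δ / 2) ^ 2)) := by gcongr
        _ = 16 * M / δ ^ 2 * (1 - r ^ 2) := by field_simp; ring
        _ ≤ _ := by linarith
  · rw [Real.circleAverage_fun_add (f₁ := fun z ↦ (ε / 2) • poissonKernel 0 r z)
      ((circleIntegrable_poissonKernel hrb).const_smul)
      (circleIntegrable_const _ _ _), Real.circleAverage_fun_smul, circleAverage_poissonKernel hrb,
      Real.circleAverage_const]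
    simpa using hr3


/-- After rotating the point to 1, subtract from the primitive its affine part `a (z - 1)`, with `a`
fitted to the derivative along the circle. The remainder `h` is `o(|z - 1|)` on the circle, so `h'`
tends to 0 along the radius, and `h'` is the rotated `f` minus a constant. -/
theorem exists_radial_limit_of_differentiableAt {f G : ℂ → ℂ} {K : NNReal} (hG : LipschitzWith K G)
    (hGf : ∀ z ∈ ball (0 : ℂ) 1, HasDerivAt G (f z) z) {t₀ : ℝ}
    (hd : DifferentiableAt ℝ (fun t : ℝ ↦ G (exp (t * I))) t₀) :
    ∃ l, Tendsto (fun r : ℝ ↦ f (r * exp (t₀ * I))) (𝓝[<] 1) (𝓝 l) := by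
  -- As `exp (s * I)` has derivative `I` at 0, matching the derivative `b` along the arc requires `a
  -- * I = b`, whence `a = -I * b`.
  obtain ⟨b, hb⟩ : ∃ b, HasDerivAt (fun t : ℝ ↦ G (exp (t * I))) b t₀ := ⟨_, hd.hasDerivAt⟩
  set ξ := exp (t₀ * I) with hξ
  have hξ1 : ‖ξ‖ = 1 := norm_exp_ofReal_mul_I t₀
  have hξ0 : ξ ≠ 0 := exp_ne_zero _
  set a : ℂ := -I * b with ha
  set h : ℂ → ℂ := fun z ↦ G (ξ * z) - G ξ - a * (z - 1) with hh
  have hmem : ∀ z ∈ ball (0 : ℂ) 1, ξ * z ∈ ball (0 : ℂ) 1 := by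
    intro z hz
    simpa [hξ1] using hz
  have hderiv : ∀ z ∈ ball (0 : ℂ) 1, HasDerivAt h (ξ * f (ξ * z) - a) z := by
    intro z hz
    have h1 : HasDerivAt (fun z ↦ ξ * z) ξ z := by simpa using (hasDerivAt_id z).const_mul ξ
    have h2 := (hGf _ (hmem z hz)).comp z h1
    have h3 : HasDerivAt (fun z ↦ a * (z - 1)) a z := by
      simpa using ((hasDerivAt_id z).sub_const 1).const_mul a
    have := (h2.sub_const (G ξ)).sub h3
    rw [mul_comm (f (ξ * z))] at this
    exact this
  have hcont : Continuous h := by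
    have := hG.continuous
    fun_prop
  have hdc : DiffContOnCl ℂ h (ball 0 1) :=
    ⟨fun z hz ↦ (hderiv z hz).differentiableAt.differentiableWithinAt, hcont.continuousOn⟩
  have hM : ∀ z : ℂ, ‖z‖ = 1 → ‖h z‖ ≤ (K + ‖a‖) * ‖z - 1‖ := by
    intro z _
    have h1 := hG.dist_le_mul (ξ * z) ξ
    rw [dist_eq_norm, dist_eq_norm] at h1
    have h2 : ξ * z - ξ = ξ * (z - 1) := by ring
    rw [h2, norm_mul, hξ1, one_mul] at h1
    calc ‖h z‖ ≤ ‖G (ξ * z) - G ξ‖ + ‖a * (z - 1)‖ := norm_sub_le _ _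
      _ ≤ K * ‖z - 1‖ + ‖a‖ * ‖z - 1‖ := by rw [norm_mul]; gcongr
      _ = _ := by ring
  have harc : HasDerivAt (fun s : ℝ ↦ h (exp (s * I))) 0 0 := by
    have h1 : HasDerivAt (fun s : ℝ ↦ G (exp ((t₀ + s : ℝ) * I))) b 0 := by
      have h2 : HasDerivAt (fun s : ℝ ↦ t₀ + s) 1 0 := (hasDerivAt_id _).const_add t₀
      have h3 : HasDerivAt (fun t : ℝ ↦ G (exp (t * I))) b (t₀ + 0) := by simpa using hb
      simpa [Function.comp_def] using HasDerivAt.scomp (𝕜 := ℝ) (𝕜' := ℝ) (0 : ℝ) h3 h2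
    have h4 : HasDerivAt (fun s : ℝ ↦ exp (s * I)) I 0 := by
      have h5 : HasDerivAt (fun z : ℂ ↦ exp (z * I)) I ((0 : ℝ) : ℂ) := by
        have := ((hasDerivAt_id ((0 : ℝ) : ℂ)).mul_const I).cexp
        simpa using this
      exact h5.comp_ofReal
    have h6 := (h1.sub_const (G ξ)).sub ((h4.sub_const 1).const_mul a)
    have h7 : b - a * I = 0 := by
      rw [ha]; linear_combination b * I_mul_I
    rw [h7] at h6
    have h8 : (fun s : ℝ ↦ h (exp (s * I)))
        = (fun s : ℝ ↦ G (exp ((t₀ + s : ℝ) * I)) - G ξ) - fun s : ℝ ↦ a * (exp (s * I) - 1) := by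
      funext s
      have : exp ((t₀ + s : ℝ) * I) = ξ * exp (s * I) := by
        rw [hξ, ← exp_add]; push_cast; ring_nf
      simp only [Pi.sub_apply, hh, this]
    rw [h8]
    exact h6
  -- Arc length is traded for chord length: on the circle `z = exp (arg z * I)`, and near 1 one has
  -- `|arg z| ≤ |log z| ≤ 2 |z - 1|`.
  have ho : ∀ ε > 0, ∀ᶠ z in 𝓝 (1 : ℂ), ‖z‖ = 1 → ‖h z‖ ≤ ε * ‖z - 1‖ := by
    intro ε hε
    have h1 := (hasDerivAt_iff_isLittleO.1 harc).def (half_pos hε)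
    have hh0 : h 1 = 0 := by simp [hh]
    have harg : Tendsto arg (𝓝 1) (𝓝 0) := by
      have := (continuousAt_arg (x := 1) (by simp)).tendsto
      simpa using this
    have hlog := (hasDerivAt_iff_isLittleO.1 (hasDerivAt_log (z := 1) (by simp))).def one_pos
    filter_upwards [harg.eventually h1, hlog] with z hz1 hz2 hz
    have hze : exp (arg z * I) = z := by
      have := norm_mul_exp_arg_mul_I z
      rwa [hz, ofReal_one, one_mul] at this
    simp only [hze, ofReal_zero, zero_mul, exp_zero, hh0, sub_zero, smul_zero] at hz1
    simp only [log_one, sub_zero, inv_one, smul_eq_mul, mul_one, one_mul] at hz2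
    have h2 : ‖log z‖ ≤ 2 * ‖z - 1‖ := by
      have := norm_sub_norm_le (log z) (z - 1)
      linarith
    have h3 : ‖arg z‖ ≤ 2 * ‖z - 1‖ := by
      rw [← log_im]
      exact (abs_im_le_norm _).trans h2
    calc ‖h z‖ ≤ ε / 2 * ‖arg z‖ := hz1
      _ ≤ ε / 2 * (2 * ‖z - 1‖) := by gcongr
      _ = _ := by ring
  have hlim := tendsto_deriv_of_isLittleO hdc hM ho
  refine ⟨a / ξ, ?_⟩
  have h8 : Tendsto (fun r : ℝ ↦ (deriv h r + a) / ξ) (𝓝[<] 1) (𝓝 ((0 + a) / ξ)) :=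
    (hlim.add_const a).div_const ξ
  rw [zero_add] at h8
  refine h8.congr' ?_
  filter_upwards [Ioo_mem_nhdsLT (zero_lt_one' ℝ)] with r hr
  have hrb : (r : ℂ) ∈ ball (0 : ℂ) 1 := by simpa [abs_of_pos hr.1] using hr.2
  rw [(hderiv r hrb).deriv, mul_comm (r : ℂ)]
  field_simp
  ring

/-- **Fatou's theorem**: a bounded analytic function on the unit disc has radial limits almost
everywhere. -/
theorem ae_exists_radial_limit {f : ℂ → ℂ} (hf : DifferentiableOn ℂ f (ball 0 1)) {C : ℝ}
    (hC : ∀ z ∈ ball (0 : ℂ) 1, ‖f z‖ ≤ C) :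
    ∀ᵐ t : ℝ, ∃ l, Tendsto (fun r : ℝ ↦ f (r * exp (t * I))) (𝓝[<] 1) (𝓝 l) := by
  -- A primitive of a bounded function is Lipschitz, so it extends to a Lipschitz function on the
  -- plane, whose restriction to the circle is differentiable almost everywhere.
  obtain ⟨F, hF⟩ := hf.isExactOn_ball
  have hC0 : 0 ≤ C := (norm_nonneg _).trans (hC 0 (by simp))
  have hLip : LipschitzOnWith C.toNNReal F (ball 0 1) :=
    (convex_ball (0 : ℂ) 1).lipschitzOnWith_of_nnnorm_hasDerivWithin_le
      (fun z hz ↦ (hF z hz).hasDerivWithinAt) (fun z hz ↦ by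
        rw [← NNReal.coe_le_coe, coe_nnnorm, Real.coe_toNNReal _ hC0]
        exact hC z hz)
  obtain ⟨G, hG, hFG⟩ := hLip.extend_finite_dimension
  have hGf : ∀ z ∈ ball (0 : ℂ) 1, HasDerivAt G (f z) z := by
    intro z hz
    refine (hF z hz).congr_of_eventuallyEq ?_
    filter_upwards [isOpen_ball.mem_nhds hz] with w hw using (hFG hw).symm
  have hexp : LipschitzWith 1 (fun t : ℝ ↦ exp (t * I)) := by
    apply lipschitzWith_of_nnnorm_deriv_le
    · fun_prop
    · intro t
      have h5 : HasDerivAt (fun z : ℂ ↦ exp (z * I)) (exp (t * I) * I) (t : ℂ) := by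
        have := ((hasDerivAt_id (t : ℂ)).mul_const I).cexp
        simpa using this
      rw [h5.comp_ofReal.deriv, ← NNReal.coe_le_coe, coe_nnnorm, norm_mul,
        norm_exp_ofReal_mul_I]
      simp
  filter_upwards [(hG.comp hexp).ae_differentiableAt_real] with t ht
  exact exists_radial_limit_of_differentiableAt hG hGf ht

end WeightedComposition

/-! ### Parseval's identity and the Hardy space -/

namespace WeightedComposition
open Real (circleAverage)
open Metric

section Parseval

lemma circleAverage_pow_mul_conj_pow (n m : ℕ) :
    circleAverage (fun z : ℂ ↦ z ^ n * conj z ^ m) 0 1 = if n = m then 1 else 0 := by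
  have hconj : ∀ z ∈ sphere (0 : ℂ) |1|, z ≠ 0 ∧ conj z = z⁻¹ := by
    intro z hz
    have hz1 : ‖z‖ = 1 := by simpa using hz
    refine ⟨norm_ne_zero_iff.1 (by rw [hz1]; exact one_ne_zero), ?_⟩
    rw [inv_def, normSq_eq_norm_sq, hz1]
    simp
  split_ifs with h
  · subst h
    rw [Real.circleAverage_congr_sphere (f₂ := fun _ ↦ (1 : ℂ)), Real.circleAverage_const]
    intro z hz
    obtain ⟨h0, h1⟩ := hconj z hz
    simp only [h1, ← mul_pow, mul_inv_cancel₀ h0, one_pow]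
  · rw [Real.circleAverage_eq_circleIntegral one_ne_zero]
    have : (∮ z in C(0, 1), (z - 0)⁻¹ • (z ^ n * conj z ^ m))
        = ∮ z in C(0, 1), (z - 0) ^ ((n : ℤ) - m - 1) := by
      apply circleIntegral.integral_congr zero_le_one
      intro z hz
      obtain ⟨h0, h1⟩ := hconj z (by simpa using hz)
      simp only [h1, sub_zero, smul_eq_mul, zpow_sub₀ h0, zpow_natCast, zpow_one, inv_pow]
      field_simp
    rw [this, circleIntegral.integral_sub_zpow_of_ne (by omega), smul_zero]

lemma circleAverage_norm_sq_sum (a : ℕ → ℂ) (N : ℕ) :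
    circleAverage (fun z : ℂ ↦ ‖∑ n ∈ Finset.range N, a n * z ^ n‖ ^ 2) 0 1
      = ∑ n ∈ Finset.range N, ‖a n‖ ^ 2 := by
  apply ofReal_injective
  have h1 := Complex.ofRealCLM.circleAverage_comp_comm (c := 0) (R := 1)
    (f := fun z : ℂ ↦ ‖∑ n ∈ Finset.range N, a n * z ^ n‖ ^ 2)
    (Continuous.continuousOn (by fun_prop)).circleIntegrable'
  have h2 : (⇑ofRealCLM ∘ fun z : ℂ ↦ ‖∑ n ∈ Finset.range N, a n * z ^ n‖ ^ 2)
      = fun z ↦ ∑ n ∈ Finset.range N, ∑ m ∈ Finset.range N,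
        (a n * conj (a m)) • (z ^ n * conj z ^ m) := by
    funext z
    simp only [Function.comp_apply, ofRealCLM_apply]
    rw [← normSq_eq_norm_sq, ← mul_conj, map_sum, Finset.sum_mul_sum]
    refine Finset.sum_congr rfl fun n _ ↦ Finset.sum_congr rfl fun m _ ↦ ?_
    simp only [map_mul, map_pow, smul_eq_mul]
    ring
  rw [h2] at h1
  refine h1.symm.trans ?_
  have hci : ∀ n m, CircleIntegrable (fun z : ℂ ↦ (a n * conj (a m)) • (z ^ n * conj z ^ m)) 0 1 :=
    fun n m ↦ (Continuous.continuousOn (by fun_prop)).circleIntegrable'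
  rw [Real.circleAverage_fun_sum fun n _ ↦ CircleIntegrable.fun_sum _ fun m _ ↦ hci n m]
  rw [ofReal_sum]
  refine Finset.sum_congr rfl fun n hn ↦ ?_
  rw [Real.circleAverage_fun_sum fun m _ ↦ hci n m]
  simp_rw [Real.circleAverage_fun_smul, circleAverage_pow_mul_conj_pow]
  simp only [smul_eq_mul, mul_ite, mul_one, mul_zero]
  rw [Finset.sum_ite_eq, if_pos hn, mul_conj, normSq_eq_norm_sq]

/-- **Parseval's identity** for absolutely convergent power series on the unit circle. -/
lemma hasSum_norm_sq_of_summable {a : ℕ → ℂ} (ha : Summable fun n ↦ ‖a n‖) {g : ℂ → ℂ}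
    (hg : ∀ z : ℂ, ‖z‖ = 1 → HasSum (fun n ↦ a n * z ^ n) (g z)) :
    HasSum (fun n ↦ ‖a n‖ ^ 2) (circleAverage (fun z ↦ ‖g z‖ ^ 2) 0 1) := by
  rw [hasSum_iff_tendsto_nat_of_nonneg (fun _ ↦ by positivity)]
  simp_rw [← circleAverage_norm_sq_sum, Real.circleAverage_def]
  apply Tendsto.const_smul
  apply intervalIntegral.tendsto_integral_filter_of_dominated_convergence
    (fun _ ↦ (∑' n, ‖a n‖) ^ 2)
  · exact Eventually.of_forall fun N ↦ Continuous.aestronglyMeasurable (by fun_prop)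
  · refine Eventually.of_forall fun N ↦ Eventually.of_forall fun t _ ↦ ?_
    rw [Real.norm_of_nonneg (by positivity)]
    gcongr
    refine (norm_sum_le _ _).trans ?_
    simp only [norm_mul, norm_pow, norm_circleMap_zero, abs_one, one_pow, mul_one]
    exact ha.sum_le_tsum _ (fun _ _ ↦ norm_nonneg _)
  · exact intervalIntegrable_const
  · refine Eventually.of_forall fun t _ ↦ ?_
    have := (hg (circleMap 0 1 t) (by simp)).tendsto_sum_nat
    exact this.norm.pow 2

/-- **Parseval's identity** for power series on the unit disc. -/
theorem hasSum_norm_sq_of_hasSum {a : ℕ → ℂ} {g : ℂ → ℂ}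
    (hg : ∀ z : ℂ, ‖z‖ < 1 → HasSum (fun n ↦ a n * z ^ n) (g z)) {r : ℝ} (h0 : 0 ≤ r)
    (h1 : r < 1) :
    HasSum (fun n ↦ ‖a n‖ ^ 2 * r ^ (2 * n)) (circleAverage (fun z ↦ ‖g z‖ ^ 2) 0 r) := by
  have hr : ‖(r : ℂ)‖ < 1 := by rwa [norm_real, Real.norm_of_nonneg h0]
  have hs : Summable fun n ↦ ‖a n * (r : ℂ) ^ n‖ := (hg r hr).summable.norm
  have := hasSum_norm_sq_of_summable (g := fun z ↦ g (r * z)) hs (fun z hz ↦ by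
    have := hg (r * z) (by rwa [norm_mul, hz, mul_one])
    simpa [mul_pow, mul_assoc] using this)
  rw [Real.circleAverage_eq_circleAverage_zero_one]
  simp only [add_zero]
  convert this using 2 with n
  rw [norm_mul, norm_pow, norm_real, Real.norm_of_nonneg h0]
  ring

end Parseval

lemma toPlane_coe (f : 𝔻 → ℂ) (z : 𝔻) : toPlane f z = f z :=
  coe_injective.extend_apply _ _ _

lemma toPlane_of_norm_lt (f : 𝔻 → ℂ) {z : ℂ} (hz : ‖z‖ < 1) :
    toPlane f z = f (UnitDisc.mk z hz) := by
  rw [← toPlane_coe f, coe_mk]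

namespace HardyTwo

/-- The orthonormal basis of monomials of `H²`. -/
noncomputable def monomialBasis : HilbertBasis ℕ ℂ HardyTwo := HilbertBasis.ofRepr coeff

lemma coeff_eq_inner (f : HardyTwo) (n : ℕ) : coeff f n = inner ℂ (monomialBasis n) f :=
  monomialBasis.repr_apply_apply f n

lemma hasSum_coeff (f : HardyTwo) (z : 𝔻) : HasSum (fun n ↦ coeff f n * (z : ℂ) ^ n) (f z) :=
  (hasSum_eval f z).summable.hasSum

lemma hasSum_coeff' (f : HardyTwo) {z : ℂ} (hz : ‖z‖ < 1) :
    HasSum (fun n ↦ coeff f n * z ^ n) (toPlane f z) := by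
  rw [toPlane_of_norm_lt _ hz]
  exact hasSum_coeff f (UnitDisc.mk z hz)

lemma monomialBasis_apply (n : ℕ) (z : 𝔻) : monomialBasis n z = (z : ℂ) ^ n := by
  have h1 : ∀ m, coeff (monomialBasis n) m = if m = n then 1 else 0 := by
    intro m
    rw [coeff_eq_inner, orthonormal_iff_ite.1 monomialBasis.orthonormal]
  have := hasSum_coeff (monomialBasis n) z
  simp only [h1] at this
  have h2 := hasSum_single (f := fun m ↦ (if m = n then (1 : ℂ) else 0) * (z : ℂ) ^ m) n
    (by intro m hm; simp [hm])
  simpa using this.unique h2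

lemma isAnalytic (f : HardyTwo) : IsAnalytic f := by
  have hp : HasFPowerSeriesOnBall (toPlane f)
      (FormalMultilinearSeries.ofScalars ℂ (fun n ↦ coeff f n)) 0 1 := by
    refine ⟨?_, one_pos, ?_⟩
    · refine ENNReal.le_of_forall_nnreal_lt fun r hr ↦ ?_
      refine FormalMultilinearSeries.le_radius_of_tendsto _ (l := 0) ?_
      have hr' : ‖((r : ℝ) : ℂ)‖ < 1 := by simpa using hr
      have := (hasSum_coeff' f hr').summable.tendsto_atTop_zero.norm
      simpa [FormalMultilinearSeries.ofScalars_norm] using this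
    · intro y hy
      have hy' : ‖y‖ < 1 := by
        rwa [Metric.mem_eball, edist_zero_right, ← ofReal_norm, ENNReal.ofReal_lt_one] at hy
      simpa [FormalMultilinearSeries.ofScalars_apply_eq, mul_comm] using hasSum_coeff' f hy'
  have := hp.differentiableOn
  intro z hz
  refine (this z ?_).mono ?_
  · simpa [Metric.mem_eball, edist_zero_right, ← ofReal_norm] using hz
  · intro w hw
    simpa [Metric.mem_eball, edist_zero_right, ← ofReal_norm] using hw

/-- By Parseval, passing to the circle of radius `r` multiplies the `n`th squared coefficient by
`r^(2n) ≤ 1`. -/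
lemma circleAverage_norm_sq_le (f : HardyTwo) {r : ℝ} (h0 : 0 ≤ r) (h1 : r < 1) :
    circleAverage (fun z ↦ ‖toPlane f z‖ ^ 2) 0 r ≤ ‖f‖ ^ 2 := by
  have h := hasSum_norm_sq_of_hasSum (fun z hz ↦ hasSum_coeff' f hz) h0 h1
  have hs : Summable fun n ↦ ‖coeff f n‖ ^ 2 := by
    have := (lp.memℓp (coeff f)).summable (by norm_num)
    exact_mod_cast this
  rw [norm_sq_eq]
  refine hasSum_le (fun n ↦ ?_) h hs.hasSum
  exact mul_le_of_le_one_right (by positivity) (pow_le_one₀ h0 h1.le)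

/-- A bounded analytic function belongs to `H²`, with norm at most its supremum norm. -/
theorem exists_of_bounded {g : 𝔻 → ℂ} (hg : IsAnalytic g) {B : ℝ} (hB0 : 0 ≤ B)
    (hB : ∀ z, ‖g z‖ ≤ B) : ∃ f : HardyTwo, (∀ z, f z = g z) ∧ ‖f‖ ≤ B := by
  set a : ℕ → ℂ := fun n ↦ (n.factorial : ℂ)⁻¹ * iteratedDeriv n (toPlane g) 0 with ha
  have hs : ∀ z : ℂ, ‖z‖ < 1 → HasSum (fun n ↦ a n * z ^ n) (toPlane g z) := by
    intro z hz
    have := Complex.hasSum_taylorSeries_on_ball (c := 0) (r := 1) (f := toPlane g) (z := z)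
      hg (by simpa using hz)
    have he : (fun n ↦ a n * z ^ n) = fun n ↦ (n.factorial : ℂ)⁻¹ • (z - 0) ^ n •
        iteratedDeriv n (toPlane g) 0 := by
      funext n
      simp only [ha, sub_zero, smul_eq_mul]
      ring
    rw [he]
    exact this
  -- Parseval on circles of radius `r < 1` bounds each damped partial sum by `B²`; since the sum is
  -- finite, `r → 1` removes the damping.
  have hpart : ∀ N, ∑ n ∈ Finset.range N, ‖a n‖ ^ 2 ≤ B ^ 2 := by
    intro N
    have hle : ∀ r : ℝ, r ∈ Set.Ioo (0 : ℝ) 1 →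
        ∑ n ∈ Finset.range N, ‖a n‖ ^ 2 * r ^ (2 * n) ≤ B ^ 2 := by
      intro r hr
      have h := hasSum_norm_sq_of_hasSum hs hr.1.le hr.2
      refine (sum_le_hasSum _ (fun n _ ↦ by have := hr.1; positivity) h).trans ?_
      have hin : ∀ z ∈ sphere (0 : ℂ) |r|, ‖z‖ < 1 := by
        intro z hz
        rw [mem_sphere_zero_iff_norm, abs_of_pos hr.1] at hz
        rw [hz]; exact hr.2
      apply Real.circleAverage_mono_on_of_le_circle
      · apply ContinuousOn.circleIntegrable'
        exact ((hg.continuousOn.mono fun z hz ↦ by simpa using hin z hz).norm).pow 2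
      · intro z hz
        rw [toPlane_of_norm_lt _ (hin z hz)]
        have := hB (UnitDisc.mk z (hin z hz))
        gcongr
    have hlim : Tendsto (fun r : ℝ ↦ ∑ n ∈ Finset.range N, ‖a n‖ ^ 2 * r ^ (2 * n)) (𝓝[<] 1)
        (𝓝 (∑ n ∈ Finset.range N, ‖a n‖ ^ 2 * 1 ^ (2 * n))) :=
      (Continuous.tendsto (by fun_prop) 1).mono_left nhdsWithin_le_nhds
    simp only [one_pow, mul_one] at hlim
    exact le_of_tendsto hlim (by
      filter_upwards [Ioo_mem_nhdsLT (zero_lt_one' ℝ)] with r hr using hle r hr)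
  have hsum : Summable fun n ↦ ‖a n‖ ^ 2 :=
    summable_of_sum_range_le (fun _ ↦ by positivity) hpart
  have hmem : Memℓp a 2 := by
    apply memℓp_gen
    simpa using hsum
  have hco : ∀ n, coeff (coeff.symm (⟨a, hmem⟩ : lp (fun _ : ℕ ↦ ℂ) 2)) n = a n := by
    intro n
    rw [LinearIsometryEquiv.apply_symm_apply]
  refine ⟨coeff.symm ⟨a, hmem⟩, fun z ↦ ?_, ?_⟩
  · have h1 := hasSum_coeff (coeff.symm (⟨a, hmem⟩ : lp (fun _ : ℕ ↦ ℂ) 2)) z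
    simp only [hco] at h1
    have h2 := hs z z.norm_lt_one
    rw [toPlane_coe] at h2
    exact h1.unique h2
  · rw [← abs_of_nonneg hB0, ← abs_of_nonneg (norm_nonneg (coeff.symm _)), ← sq_le_sq, norm_sq_eq]
    simp only [hco]
    exact hsum.tsum_le_of_sum_range_le hpart

end HardyTwo

end WeightedComposition

/-! ### Singular numbers and Schatten classes -/

namespace WeightedComposition

section Operators

variable {H : Type*} [NormedAddCommGroup H] [InnerProductSpace ℂ H]

/-- The orthogonal projection estimate of Bessel type: the squared lengths of the projections of an
orthonormal family to a finite-dimensional subspace add up to at most its dimension. -/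
lemma sum_norm_sq_proj_le (E : Submodule ℂ H) [FiniteDimensional ℂ E] {ι : Type*} {e : ι → H}
    (he : Orthonormal ℂ e) (s : Finset ι) :
    ∑ n ∈ s, ‖E.starProjection (e n)‖ ^ 2 ≤ Module.finrank ℂ E := by
  let b := stdOrthonormalBasis ℂ E
  have h1 : ∀ x : H, ‖E.starProjection x‖ ^ 2 = ∑ j, ‖inner ℂ x ((b j : E) : H)‖ ^ 2 := by
    intro x
    rw [Submodule.starProjection_apply]
    refine (b.sum_sq_norm_inner_left (E.orthogonalProjectionOnto x)).symm.trans ?_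
    refine Finset.sum_congr rfl fun j _ ↦ ?_
    rw [Submodule.coe_inner, ← Submodule.starProjection_apply,
      Submodule.inner_starProjection_left_eq_right,
      Submodule.starProjection_eq_self_iff.2 (b j).2]
  simp_rw [h1]
  rw [Finset.sum_comm]
  calc ∑ j, ∑ n ∈ s, ‖inner ℂ (e n) ((b j : E) : H)‖ ^ 2
      ≤ ∑ j : Fin (Module.finrank ℂ E), (1 : ℝ) := by
        refine Finset.sum_le_sum fun j _ ↦ ?_
        refine (he.sum_inner_products_le _).trans ?_
        have : ‖((b j : E) : H)‖ = 1 := b.norm_eq_one j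
        rw [this]; norm_num
    _ = Module.finrank ℂ E := by simp

open Module.End in
lemma isClosed_eigenspace (A : H →L[ℂ] H) (μ : ℂ) :
    IsClosed (eigenspace A.toLinearMap μ : Set H) := by
  have : (eigenspace A.toLinearMap μ : Set H) = {x | A x = μ • x} := by
    ext x
    simp
  rw [this]
  exact isClosed_eq A.continuous (continuous_const_smul μ)

variable [CompleteSpace H]

lemma abs_isPositive (T : H →L[ℂ] H) : (CFC.abs T : H →L[ℂ] H).IsPositive :=
  (ContinuousLinearMap.nonneg_iff_isPositive _).1 (CFC.abs_nonneg T)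

lemma abs_isSymmetric (T : H →L[ℂ] H) : (CFC.abs T : H →L[ℂ] H).toLinearMap.IsSymmetric :=
  (abs_isPositive T).isSymmetric

lemma norm_abs_apply (T : H →L[ℂ] H) (x : H) : ‖(CFC.abs T : H →L[ℂ] H) x‖ = ‖T x‖ := by
  have h1 : inner ℂ ((CFC.abs T : H →L[ℂ] H) x) ((CFC.abs T : H →L[ℂ] H) x)
      = inner ℂ (T x) (T x) := by
    have h2 := abs_isSymmetric T x ((CFC.abs T : H →L[ℂ] H) x)
    have h3 : (CFC.abs T : H →L[ℂ] H) ((CFC.abs T : H →L[ℂ] H) x) = (star T * T) x := by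
      rw [← CFC.abs_mul_abs]; rfl
    have h4 : inner ℂ ((CFC.abs T : H →L[ℂ] H) x) ((CFC.abs T : H →L[ℂ] H) x)
        = inner ℂ x ((CFC.abs T : H →L[ℂ] H) ((CFC.abs T : H →L[ℂ] H) x)) := h2
    rw [h4, h3, mul_apply_eq_comp, ContinuousLinearMap.star_eq_adjoint,
      ContinuousLinearMap.adjoint_inner_right]
  have h5 : ‖(CFC.abs T : H →L[ℂ] H) x‖ ^ 2 = ‖T x‖ ^ 2 := by
    rw [inner_self_eq_norm_sq_to_K, inner_self_eq_norm_sq_to_K] at h1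
    exact_mod_cast h1
  exact (pow_left_inj₀ (norm_nonneg _) (norm_nonneg _) two_ne_zero).1 h5

/-- Since `|T|` and `T` have equal norms on every vector, preimages of the centres of an `ε`-net for
the image of the ball under `T` give an `ε`-net for its image under `|T|`. -/
lemma isCompactOperator_abs {T : H →L[ℂ] H} (hT : IsCompactOperator T) :
    IsCompactOperator (CFC.abs T : H →L[ℂ] H) := by
  set A : H →L[ℂ] H := CFC.abs T with hA
  have key : TotallyBounded (A '' Metric.closedBall 0 1) := by
    have h1 : TotallyBounded (T '' Metric.closedBall 0 1) :=
      ((hT.isCompact_closure_image_closedBall 1).totallyBounded).subset subset_closure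
    rw [Metric.totallyBounded_iff]
    intro ε hε
    obtain ⟨t, hts, htf, ht⟩ := Metric.finite_approx_of_totallyBounded h1 ε hε
    have hts' : ∀ y ∈ t, ∃ x ∈ Metric.closedBall (0 : H) 1, T x = y := hts
    choose! g hg hgt using hts'
    refine ⟨(fun y ↦ A (g y)) '' t, htf.image _, ?_⟩
    rintro _ ⟨x, hx, rfl⟩
    obtain ⟨y, hy, hxy⟩ := Set.mem_iUnion₂.1 (ht ⟨x, hx, rfl⟩)
    refine Set.mem_iUnion₂.2 ⟨_, ⟨y, hy, rfl⟩, ?_⟩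
    rw [Metric.mem_ball, dist_eq_norm] at hxy ⊢
    rw [← map_sub, hA, norm_abs_apply, map_sub, hgt y hy]
    exact hxy
  exact (isCompactOperator_iff_isCompact_closure_image_closedBall (A : H →ₗ[ℂ] H) one_pos).2
    (key.closure.isCompact_of_isClosed isClosed_closure)

lemma hasOrthogonalProjection_eigenspace (A : H →L[ℂ] H) (μ : ℂ) :
    (Module.End.eigenspace A.toLinearMap μ).HasOrthogonalProjection := by
  have : CompleteSpace (Module.End.eigenspace A.toLinearMap μ) :=
    (isClosed_eigenspace A μ).completeSpace_coe
  infer_instance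

open Module.End in
/-- Spectral estimate for compact self-adjoint operators: off the eigenspaces of the eigenvalues
larger than `δ` the operator has norm at most `δ`. -/
lemma norm_sq_apply_le_of_eigenvalues {A : H →L[ℂ] H}
    [∀ μ, (eigenspace A.toLinearMap μ).HasOrthogonalProjection] (hA : IsCompactOperator A)
    (hs : A.toLinearMap.IsSymmetric) {δ : ℝ} (M : Finset ℂ)
    (hM : ∀ μ, HasEigenvalue A.toLinearMap μ → δ < ‖μ‖ → μ ∈ M) (x : H) :
    ‖A x‖ ^ 2 ≤ δ ^ 2 * ‖x‖ ^ 2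
      + ‖A‖ ^ 2 * ∑ μ ∈ M, ‖(eigenspace A.toLinearMap μ).starProjection x‖ ^ 2 := by
  classical
  set E : ℂ → Submodule ℂ H := fun μ ↦ eigenspace A.toLinearMap μ with hE
  have hdense : (⨆ μ, E μ).topologicalClosure = ⊤ := by
    rw [Submodule.topologicalClosure_eq_top_iff]
    exact ContinuousLinearMap.orthogonalComplement_iSup_eigenspaces_eq_bot hA hs
  have horth := hs.orthogonalFamily_eigenspaces
  have hclosed : IsClosed {x : H | ‖A x‖ ^ 2 ≤ δ ^ 2 * ‖x‖ ^ 2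
      + ‖A‖ ^ 2 * ∑ μ ∈ M, ‖(E μ).starProjection x‖ ^ 2} :=
    isClosed_le (by fun_prop) (by fun_prop)
  -- The inequality is a closed condition and the eigenvectors span a dense subspace, so it need
  -- only be checked on finite sums of eigenvectors, where it follows from Pythagoras.
  have hmem : x ∈ closure ((⨆ μ, E μ : Submodule ℂ H) : Set H) := by
    rw [← Submodule.topologicalClosure_coe, hdense]; trivial
  refine closure_minimal ?_ hclosed hmem
  intro y hy
  obtain ⟨f, hf, rfl⟩ := (Submodule.mem_iSup_iff_exists_finsupp _ _).1 hy
  have hAf : ∀ μ, A (f μ) = μ • f μ := fun μ ↦ mem_eigenspace_iff.1 (hf μ)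
  have hn1 : ‖f.sum fun _ v ↦ v‖ ^ 2 = ∑ μ ∈ f.support, ‖f μ‖ ^ 2 :=
    horth.norm_sum (fun μ ↦ ⟨f μ, hf μ⟩) f.support
  have hn2 : ‖A (f.sum fun _ v ↦ v)‖ ^ 2 = ∑ μ ∈ f.support, ‖A (f μ)‖ ^ 2 := by
    rw [Finsupp.sum, map_sum]
    exact horth.norm_sum
      (fun μ ↦ ⟨A (f μ), by rw [hAf]; exact Submodule.smul_mem _ _ (hf μ)⟩) f.support
  have hproj : ∀ μ, (E μ).starProjection (f.sum fun _ v ↦ v) = f μ := by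
    intro μ
    rw [Finsupp.sum, map_sum]
    have h1 : ∀ ν ∈ f.support, (E μ).starProjection (f ν) = if ν = μ then f μ else 0 := by
      intro ν _
      split_ifs with h
      · rw [h]; exact Submodule.starProjection_eq_self_iff.2 (hf μ)
      · rw [Submodule.starProjection_apply_eq_zero_iff, Submodule.mem_orthogonal]
        intro u hu
        exact horth (Ne.symm h) ⟨u, hu⟩ ⟨f ν, hf ν⟩
    rw [Finset.sum_congr rfl h1, Finset.sum_ite_eq' f.support μ]
    split_ifs with h
    · rfl
    · exact (Finsupp.notMem_support_iff.1 h).symm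
  simp only [Set.mem_ofPred_eq, hn1, hn2, hproj]
  rw [Finset.mul_sum, Finset.mul_sum]
  have hterm : ∀ μ ∈ f.support, ‖A (f μ)‖ ^ 2
      ≤ δ ^ 2 * ‖f μ‖ ^ 2 + if μ ∈ M then ‖A‖ ^ 2 * ‖f μ‖ ^ 2 else 0 := by
    intro μ hμ
    have hμ0 : f μ ≠ 0 := Finsupp.mem_support_iff.1 hμ
    split_ifs with h
    · have := A.le_opNorm (f μ)
      have h2 : ‖A (f μ)‖ ^ 2 ≤ (‖A‖ * ‖f μ‖) ^ 2 := by gcongr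
      rw [mul_pow] at h2
      have : 0 ≤ δ ^ 2 * ‖f μ‖ ^ 2 := by positivity
      linarith
    · have hev : HasEigenvalue A.toLinearMap μ := hasEigenvalue_of_hasEigenvector ⟨hf μ, hμ0⟩
      have hle : ‖μ‖ ≤ δ := by
        by_contra hc
        exact h (hM μ hev (not_le.1 hc))
      rw [hAf, norm_smul, mul_pow, add_zero]
      gcongr
  refine (Finset.sum_le_sum hterm).trans ?_
  rw [Finset.sum_add_distrib]
  gcongr
  rw [← Finset.sum_filter]
  refine Finset.sum_le_sum_of_subset_of_nonneg (fun μ hμ ↦ (Finset.mem_filter.1 hμ).2) ?_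
  intros; positivity

open Module.End in
-- Chebyshev's inequality: each eigenvalue above `δ` adds at least `δ ^ p` per dimension of its
-- eigenspace to the singular sum.
lemma exists_finset_eigenvalues_abs {T : H →L[ℂ] H} {p δ : ℝ} (hp : 0 < p)
    (hS : singularSum p T < ∞) (hδ : 0 < δ) (hT : IsCompactOperator T) :
    ∃ M : Finset ℂ, (∀ μ, HasEigenvalue (CFC.abs T : H →L[ℂ] H).toLinearMap μ → δ < ‖μ‖ → μ ∈ M) ∧
      (∀ μ ∈ M, μ ≠ 0) ∧
      ∑ μ ∈ M, (Module.finrank ℂ (eigenspace (CFC.abs T : H →L[ℂ] H).toLinearMap μ) : ℝ)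
        ≤ (singularSum p T).toReal * δ ^ (-p) := by
  classical
  set A : H →L[ℂ] H := CFC.abs T with hA
  set g : Set.Ioi (0 : ℝ) → ℝ≥0∞ := fun μ ↦
    (Module.finrank ℂ (eigenspace A.toLinearMap ((μ : ℝ) : ℂ)) : ℝ≥0∞)
      * ENNReal.ofReal ((μ : ℝ) ^ p) with hg
  have hgS : ∑' μ, g μ = singularSum p T := rfl
  have hδp : 0 < δ ^ p := Real.rpow_pos_of_pos hδ p
  have hfin : {μ | ENNReal.ofReal (δ ^ p) ≤ g μ}.Finite :=
    ENNReal.finite_const_le_of_tsum_ne_top (by rw [hgS]; exact hS.ne) (by simpa using hδp)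
  set M₀ : Finset (Set.Ioi (0 : ℝ)) := hfin.toFinset.filter (fun μ : Set.Ioi (0 : ℝ) ↦ δ < (μ : ℝ)) with hM₀
  refine ⟨M₀.image (fun μ : Set.Ioi (0 : ℝ) ↦ ((μ : ℝ) : ℂ)), ?_, ?_, ?_⟩
  · intro μ hμ hδμ
    have hreal : ((μ.re : ℝ) : ℂ) = μ := by
      have := (abs_isSymmetric T).conj_eigenvalue_eq_self hμ
      exact conj_eq_iff_re.1 this
    have hnn : 0 ≤ μ.re := by
      refine eigenvalue_nonneg_of_nonneg (μ := μ.re) (T := A.toLinearMap)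
        (by rw [← hreal] at hμ; exact hμ) fun x ↦ ?_
      have := (abs_isPositive T).inner_nonneg_right x
      exact (RCLike.nonneg_iff.1 this).1
    have hnorm : ‖μ‖ = μ.re := by
      rw [← hreal, norm_real, Real.norm_of_nonneg hnn]; simp
    rw [hnorm] at hδμ
    refine Finset.mem_image.2 ⟨⟨μ.re, hδ.trans hδμ⟩, ?_, hreal⟩
    rw [hM₀, Finset.mem_filter, Set.Finite.mem_toFinset]
    refine ⟨?_, hδμ⟩
    have hμ0 : ((μ.re : ℝ) : ℂ) ≠ 0 := by
      exact_mod_cast (hδ.trans hδμ).ne'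
    -- Compactness makes the eigenspace finite-dimensional, which excludes the default value 0 of
    -- `finrank`.
    have := ContinuousLinearMap.finite_dimensional_eigenspace (isCompactOperator_abs hT)
      ((μ.re : ℝ) : ℂ) hμ0
    have h1 : 1 ≤ Module.finrank ℂ (eigenspace A.toLinearMap ((μ.re : ℝ) : ℂ)) := by
      rw [hreal] at this ⊢
      rw [Nat.one_le_iff_ne_zero]
      intro h0
      exact hμ (Submodule.finrank_eq_zero.1 h0)
    simp only [Set.mem_ofPred_eq, hg]
    calc ENNReal.ofReal (δ ^ p) = 1 * ENNReal.ofReal (δ ^ p) := (one_mul _).symm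
      _ ≤ _ := by
        gcongr
        exact_mod_cast h1
  · intro μ hμ
    obtain ⟨ν, _, rfl⟩ := Finset.mem_image.1 hμ
    exact_mod_cast (ne_of_gt ν.2)
  · rw [Finset.sum_image (by
      intro a _ b _ hab
      exact Subtype.ext (ofReal_injective hab))]
    rw [Real.rpow_neg hδ.le, ← div_eq_mul_inv, le_div_iff₀ hδp, Finset.sum_mul]
    have h1 : ∑ μ ∈ M₀, g μ ≤ singularSum p T := hgS ▸ ENNReal.sum_le_tsum M₀
    have h2 : ∀ μ ∈ M₀, ENNReal.ofReal
        ((Module.finrank ℂ (eigenspace A.toLinearMap ((μ : ℝ) : ℂ)) : ℝ) * δ ^ p) ≤ g μ := by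
      intro μ hμ
      rw [ENNReal.ofReal_mul (by positivity), ENNReal.ofReal_natCast]
      have := (Finset.mem_filter.1 hμ).2
      simp only [hg]
      gcongr
    rw [← ENNReal.ofReal_le_iff_le_toReal hS.ne, ENNReal.ofReal_sum_of_nonneg
      (by intros; positivity)]
    exact (Finset.sum_le_sum h2).trans h1

/-- The images of an orthonormal sequence under an operator of Schatten class decay in quadratic
mean at a polynomial rate. -/
theorem IsSchatten.exists_sum_norm_sq_le {T : H →L[ℂ] H} {p : ℝ} (hp : 0 < p)
    (hT : IsSchatten p T) {e : ℕ → H} (he : Orthonormal ℂ e) :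
    ∃ C, 0 ≤ C ∧ ∀ N : ℕ, 0 < N →
      ∑ n ∈ Finset.range N, ‖T (e n)‖ ^ 2 ≤ C * (N : ℝ) ^ (1 - 2 / (p + 2)) := by
  obtain ⟨hc, hS⟩ := hT
  set A : H →L[ℂ] H := CFC.abs T with hA
  have := hasOrthogonalProjection_eigenspace A
  set S := (singularSum p T).toReal with hSdef
  refine ⟨1 + ‖A‖ ^ 2 * S, by positivity, fun N hN ↦ ?_⟩
  have hN0 : (0 : ℝ) < N := by exact_mod_cast hN
  -- This threshold balances the two error terms: `δ² N` and `δ ^ (-p)` become the same power of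
  -- `N`.
  set δ : ℝ := (N : ℝ) ^ (-(1 / (p + 2))) with hδdef
  have hδ : 0 < δ := Real.rpow_pos_of_pos hN0 _
  obtain ⟨M, hM1, hM0, hM2⟩ := exists_finset_eigenvalues_abs hp hS hδ hc
  have h1 : ∀ n, ‖T (e n)‖ ^ 2 ≤ δ ^ 2 + ‖A‖ ^ 2 * ∑ μ ∈ M,
      ‖(Module.End.eigenspace A.toLinearMap μ).starProjection (e n)‖ ^ 2 := by
    intro n
    have := norm_sq_apply_le_of_eigenvalues (isCompactOperator_abs hc) (abs_isSymmetric T) M hM1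
      (e n)
    rw [norm_abs_apply, he.1 n] at this
    rwa [one_pow, mul_one] at this
  have h2 : ∀ μ ∈ M, ∑ n ∈ Finset.range N,
      ‖(Module.End.eigenspace A.toLinearMap μ).starProjection (e n)‖ ^ 2
        ≤ Module.finrank ℂ (Module.End.eigenspace A.toLinearMap μ) := by
    intro μ hμ
    have := ContinuousLinearMap.finite_dimensional_eigenspace (isCompactOperator_abs hc) μ
      (hM0 μ hμ)
    exact sum_norm_sq_proj_le _ he _
  have hp2 : p + 2 ≠ 0 := by positivity
  have e1 : δ ^ 2 * N = (N : ℝ) ^ (1 - 2 / (p + 2)) := by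
    rw [hδdef, ← Real.rpow_natCast, ← Real.rpow_mul hN0.le]
    nth_rw 2 [← Real.rpow_one (N : ℝ)]
    rw [← Real.rpow_add hN0]
    congr 1
    push_cast
    ring
  have e2 : δ ^ (-p) = (N : ℝ) ^ (1 - 2 / (p + 2)) := by
    rw [hδdef, ← Real.rpow_mul hN0.le]
    congr 1
    field_simp
    ring
  calc ∑ n ∈ Finset.range N, ‖T (e n)‖ ^ 2
      ≤ ∑ n ∈ Finset.range N, (δ ^ 2 + ‖A‖ ^ 2 * ∑ μ ∈ M,
        ‖(Module.End.eigenspace A.toLinearMap μ).starProjection (e n)‖ ^ 2) :=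
        Finset.sum_le_sum fun n _ ↦ h1 n
    _ = δ ^ 2 * N + ‖A‖ ^ 2 * ∑ μ ∈ M, ∑ n ∈ Finset.range N,
        ‖(Module.End.eigenspace A.toLinearMap μ).starProjection (e n)‖ ^ 2 := by
        rw [Finset.sum_add_distrib, ← Finset.mul_sum, Finset.sum_comm]
        simp [mul_comm]
    _ ≤ δ ^ 2 * N + ‖A‖ ^ 2 * (S * δ ^ (-p)) := by
        gcongr
        exact (Finset.sum_le_sum h2).trans hM2
    _ = (1 + ‖A‖ ^ 2 * S) * (N : ℝ) ^ (1 - 2 / (p + 2)) := by rw [e1, e2]; ring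

/-- A minimax principle: among `m + 1` orthonormal eigenvectors of `|T|` one has an eigenvalue at
most the norm of `T` on a subspace of codimension `m`. -/
lemma exists_eigenvalue_le {T : H →L[ℂ] H} {e : ℕ → H} {m : ℕ} {c : ℝ} (hc0 : 0 ≤ c)
    (hc : ∀ x : H, (∀ n < m, inner ℂ (e n) x = 0) → ‖T x‖ ≤ c * ‖x‖)
    {ι : Type*} {v : ι → H} (hv : Orthonormal ℂ v) {l : ι → ℝ}
    (hl : ∀ i, (CFC.abs T : H →L[ℂ] H) (v i) = ((l i : ℝ) : ℂ) • v i) {s : Finset ι}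
    (hs : s.card = m + 1) : ∃ i ∈ s, l i ≤ c := by
  by_contra! hcon
  -- A linear map from dimension `m + 1` to dimension `m` has a kernel, so some nonzero combination
  -- of the eigenvectors is orthogonal to `e 0, …, e (m - 1)`. If all their eigenvalues exceeded
  -- `c`, it would violate the bound on `T`.
  let Φ : (s → ℂ) →ₗ[ℂ] (Fin m → ℂ) := LinearMap.pi fun n ↦
    (innerSL ℂ (e n)).toLinearMap ∘ₗ (Fintype.linearCombination ℂ (fun i : s ↦ v i))
  have hker : LinearMap.ker Φ ≠ ⊥ := by
    apply LinearMap.ker_ne_bot_of_finrank_lt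
    simp [hs]
  obtain ⟨a, ha, ha0⟩ := (Submodule.ne_bot_iff _).1 hker
  have hv' : Orthonormal ℂ (fun i : s ↦ v i) := hv.comp _ Subtype.val_injective
  set x : H := ∑ i : s, a i • v i with hx
  have hxe : ∀ n < m, inner ℂ (e n) x = 0 := by
    intro n hn
    have := congrFun (LinearMap.mem_ker.1 ha) ⟨n, hn⟩
    exact this
  have hxn : ‖x‖ ^ 2 = ∑ i : s, ‖a i‖ ^ 2 := by
    have h1 := hv'.inner_sum a a Finset.univ
    rw [← hx, inner_self_eq_norm_sq_to_K] at h1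
    have h2 : ∀ i : s, conj (a i) * a i = ((‖a i‖ ^ 2 : ℝ) : ℂ) := by
      intro i; rw [mul_comm, mul_conj, normSq_eq_norm_sq]
    rw [Finset.sum_congr rfl fun i _ ↦ h2 i, ← ofReal_sum] at h1
    refine ofReal_injective (Eq.trans ?_ h1)
    rw [ofReal_pow]
    rfl
  have hTx : ‖T x‖ ^ 2 = ∑ i : s, (l i * ‖a i‖) ^ 2 := by
    have h0 : (CFC.abs T : H →L[ℂ] H) x = ∑ i : s, (((l i : ℝ) : ℂ) * a i) • v i := by
      rw [hx, map_sum]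
      refine Finset.sum_congr rfl fun i _ ↦ ?_
      rw [map_smul, hl, smul_smul, mul_comm]
    have h1 := hv'.inner_sum (fun i ↦ ((l i : ℝ) : ℂ) * a i) (fun i ↦ ((l i : ℝ) : ℂ) * a i)
      Finset.univ
    rw [← h0, inner_self_eq_norm_sq_to_K, norm_abs_apply] at h1
    have h2 : ∀ i : s, conj (((l i : ℝ) : ℂ) * a i) * (((l i : ℝ) : ℂ) * a i)
        = (((l i * ‖a i‖) ^ 2 : ℝ) : ℂ) := by
      intro i
      rw [mul_comm, mul_conj, normSq_eq_norm_sq, norm_mul, norm_real, mul_pow, mul_pow,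
        Real.norm_eq_abs, sq_abs]
    rw [Finset.sum_congr rfl fun i _ ↦ h2 i, ← ofReal_sum] at h1
    refine ofReal_injective (Eq.trans ?_ h1)
    rw [ofReal_pow]
    rfl
  have hle : ‖T x‖ ^ 2 ≤ c ^ 2 * ‖x‖ ^ 2 := by
    rw [← mul_pow]; gcongr; exact hc x hxe
  rw [hTx, hxn, Finset.mul_sum] at hle
  refine absurd hle (not_le.2 ?_)
  obtain ⟨j, hj⟩ := Function.ne_iff.1 ha0
  refine Finset.sum_lt_sum (fun i _ ↦ ?_) ⟨j, Finset.mem_univ _, ?_⟩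
  · rw [mul_pow]
    have := (hcon i i.2).le
    gcongr
  · rw [mul_pow]
    have h1 := hcon j j.2
    have h2 : 0 < ‖a j‖ := norm_pos_iff.2 hj
    gcongr

/-- This replaces sorting the values in decreasing order: remove an element whose value is at most
the last bound, and induct on the remaining ones. -/
lemma sum_le_sum_range_of_exists_le {ι : Type*} {c : ℕ → ℝ≥0∞} {f : ι → ℝ≥0∞} (s : Finset ι)
    (h : ∀ t ⊆ s, ∀ m, t.card = m + 1 → ∃ i ∈ t, f i ≤ c m) :
    ∑ i ∈ s, f i ≤ ∑ m ∈ Finset.range s.card, c m := by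
  classical
  induction hn : s.card generalizing s with
  | zero => simp [Finset.card_eq_zero.1 hn]
  | succ n ih =>
    obtain ⟨i, hi, hle⟩ := h s subset_rfl n hn
    have hcard : (s.erase i).card = n := by rw [Finset.card_erase_of_mem hi, hn]; rfl
    have := ih (s.erase i) (fun t ht ↦ h t (ht.trans (Finset.erase_subset _ _))) hcard
    rw [Finset.sum_range_succ, ← Finset.sum_erase_add s f hi]
    exact add_le_add this hle

/-- Bound for the singular numbers of an operator in terms of its norms on the orthogonal
complements of the first vectors of a sequence. -/
theorem singularSum_le {T : H →L[ℂ] H} {e : ℕ → H} {c : ℕ → ℝ} (hc0 : ∀ m, 0 ≤ c m)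
    (hc : ∀ m, ∀ x : H, (∀ n < m, inner ℂ (e n) x = 0) → ‖T x‖ ≤ c m * ‖x‖) {p : ℝ} (hp : 0 < p) :
    singularSum p T ≤ ∑' m, ENNReal.ofReal (c m ^ p) := by
  set A : H →L[ℂ] H := CFC.abs T with hA
  set E : Set.Ioi (0 : ℝ) → Submodule ℂ H :=
    fun μ ↦ Module.End.eigenspace A.toLinearMap ((μ : ℝ) : ℂ) with hE
  have hb : ∀ μ, ∃ b : Fin (Module.finrank ℂ (E μ)) → E μ, Orthonormal ℂ b := by
    intro μ
    by_cases h : FiniteDimensional ℂ (E μ)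
    · exact ⟨stdOrthonormalBasis ℂ (E μ), (stdOrthonormalBasis ℂ (E μ)).orthonormal⟩
    -- `finrank` is 0 by default in infinite dimension, and so is the contribution to `singularSum`;
    -- the empty family matches it.
    · have : Module.finrank ℂ (E μ) = 0 := Module.finrank_of_not_finite h
      rw [this]
      exact ⟨Fin.elim0, ⟨fun i ↦ i.elim0, fun i ↦ i.elim0⟩⟩
  choose b hb using hb
  have horth : OrthogonalFamily ℂ (fun μ ↦ E μ) fun μ ↦ (E μ).subtypeₗᵢ :=
    ((abs_isSymmetric T).orthogonalFamily_eigenspaces).comp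
      (γ := Set.Ioi (0 : ℝ)) (f := fun μ ↦ ((μ : ℝ) : ℂ))
      (fun a b hab ↦ Subtype.ext (ofReal_injective hab))
  have hv := horth.orthonormal_sigma_orthonormal hb
  have hsum : singularSum p T = ∑' i : (Σ μ, Fin (Module.finrank ℂ (E μ))),
      ENNReal.ofReal ((i.1 : ℝ) ^ p) := by
    rw [ENNReal.tsum_sigma']
    refine tsum_congr fun μ ↦ ?_
    simp only [tsum_fintype, Finset.sum_const, Finset.card_univ, Fintype.card_fin, nsmul_eq_mul]
    rfl
  rw [hsum, ENNReal.tsum_eq_iSup_sum]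
  refine iSup_le fun s ↦ ?_
  refine (sum_le_sum_range_of_exists_le (c := fun m ↦ ENNReal.ofReal (c m ^ p)) s ?_).trans
    (ENNReal.sum_le_tsum _)
  intro t _ m hm
  obtain ⟨i, hi, hle⟩ := exists_eigenvalue_le (hc0 m) (hc m) hv (l := fun i ↦ (i.1 : ℝ))
    (fun i ↦ Module.End.mem_eigenspace_iff.1 (b i.1 i.2).2) hm
  refine ⟨i, hi, ?_⟩
  have : (0 : ℝ) < i.1 := i.1.2
  gcongr

end Operators

end WeightedComposition

/-! ### Boundary values and the Poisson majorant of the logarithm -/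

namespace WeightedComposition
open Real (circleAverage)
open Metric

/-- The function `log (1 / (1 - x))` on `[0, 1]`, as a sum with values in `[0, ∞]`. -/
noncomputable def logSeries (x : ℝ) : ℝ≥0∞ := ∑' n : ℕ, ENNReal.ofReal (x ^ (n + 1) / (n + 1))

lemma logSeries_eq_ofReal {x : ℝ} (h0 : 0 ≤ x) (h1 : x < 1) :
    logSeries x = ENNReal.ofReal (-Real.log (1 - x)) := by
  have h := Real.hasSum_pow_div_log_of_abs_lt_one (x := x) (by rwa [abs_of_nonneg h0])
  rw [logSeries, ← ENNReal.ofReal_tsum_of_nonneg (fun n ↦ by positivity) h.summable, h.tsum_eq]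

lemma logSeries_one : logSeries 1 = ∞ := by
  by_contra h
  have h1 := ENNReal.summable_toReal h
  refine Real.not_summable_one_div_natCast ((summable_nat_add_iff 1).1 (h1.congr fun n ↦ ?_))
  rw [ENNReal.toReal_ofReal (by positivity)]
  push_cast
  simp

lemma toENNReal_log_eq_logSeries {x : ℝ} (h0 : 0 ≤ x) (h1 : x ≤ 1) :
    (ENNReal.log (1 / ENNReal.ofReal (1 - x))).toENNReal = logSeries x := by
  rcases h1.lt_or_eq with h | rfl
  · rw [logSeries_eq_ofReal h0 h]
    have hx : 0 < 1 - x := by linarith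
    rw [one_div, ← ENNReal.ofReal_inv_of_pos hx, ENNReal.log_ofReal_of_pos (inv_pos.2 hx),
      Real.log_inv, EReal.toENNReal_of_ne_top (EReal.coe_ne_top _), EReal.toReal_coe]
  · simp [logSeries_one]

lemma measurable_logSeries : Measurable logSeries := by
  unfold logSeries
  fun_prop

/-- Lebesgue measure on a period of the circle. -/
noncomputable def arcMeasure : Measure ℝ := volume.restrict (Set.Ioc 0 (2 * Real.pi))

instance : IsFiniteMeasure arcMeasure := by unfold arcMeasure; infer_instance

lemma circleAverage_eq_integral_arcMeasure (f : ℂ → ℝ) (r : ℝ) :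
    circleAverage f 0 r = (2 * Real.pi)⁻¹ * ∫ t, f (circleMap 0 r t) ∂arcMeasure := by
  rw [Real.circleAverage_def, intervalIntegral.integral_of_le Real.two_pi_pos.le, smul_eq_mul]
  rfl

lemma circleIntegrable_iff_integrable (f : ℂ → ℝ) (r : ℝ) :
    CircleIntegrable f 0 r ↔ Integrable (fun t ↦ f (circleMap 0 r t)) arcMeasure := by
  rw [CircleIntegrable, intervalIntegrable_iff, Set.uIoc_of_le Real.two_pi_pos.le]
  rfl

lemma ofReal_circleAverage {f : ℂ → ℝ} {r : ℝ} (hf : CircleIntegrable f 0 r)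
    (h0 : ∀ t, 0 ≤ f (circleMap 0 r t)) :
    ENNReal.ofReal (circleAverage f 0 r)
      = ENNReal.ofReal (2 * Real.pi)⁻¹ * ∫⁻ t, ENNReal.ofReal (f (circleMap 0 r t)) ∂arcMeasure := by
  rw [circleAverage_eq_integral_arcMeasure, ENNReal.ofReal_mul (by positivity),
    ofReal_integral_eq_lintegral_ofReal ((circleIntegrable_iff_integrable f r).1 hf)
      (Eventually.of_forall h0)]

/-- The boundary function of a function on the disc, as a function on the plane. -/
noncomputable def boundary (Φ : ℂ → ℂ) (ζ : ℂ) : ℂ :=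
  limUnder (𝓝[<] (1 : ℝ)) fun r : ℝ ↦ Φ (r * ζ)

lemma radialLimit_exp (f : 𝔻 → ℂ) (t : ℝ) :
    radialLimit f (Circle.exp t) = boundary (toPlane f) (circleMap 0 1 t) := by
  simp [radialLimit, boundary, circleMap]

section Boundary

variable {Φ : ℂ → ℂ}

lemma ae_tendsto_boundary (hΦ : DifferentiableOn ℂ Φ (ball 0 1))
    (hb : ∀ z ∈ ball (0 : ℂ) 1, ‖Φ z‖ ≤ 1) :
    ∀ᵐ t ∂arcMeasure, Tendsto (fun r : ℝ ↦ Φ (r * circleMap 0 1 t)) (𝓝[<] 1)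
      (𝓝 (boundary Φ (circleMap 0 1 t))) := by
  refine ae_restrict_of_ae ?_
  filter_upwards [ae_exists_radial_limit hΦ hb] with t ht
  apply tendsto_nhds_limUnder
  simpa [circleMap] using ht

lemma mul_circleMap_mem_ball {r : ℝ} (hr : r ∈ Set.Ioo (0 : ℝ) 1) (t : ℝ) :
    (r : ℂ) * circleMap 0 1 t ∈ ball (0 : ℂ) 1 := by
  simpa [abs_of_pos hr.1] using hr.2

lemma continuous_radial (hΦ : DifferentiableOn ℂ Φ (ball 0 1)) {r : ℝ}
    (hr : r ∈ Set.Ioo (0 : ℝ) 1) : Continuous fun t : ℝ ↦ Φ (r * circleMap 0 1 t) := by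
  apply hΦ.continuousOn.comp_continuous (by fun_prop)
  exact fun t ↦ mul_circleMap_mem_ball hr t

lemma ae_norm_boundary_le (hΦ : DifferentiableOn ℂ Φ (ball 0 1))
    (hb : ∀ z ∈ ball (0 : ℂ) 1, ‖Φ z‖ ≤ 1) :
    ∀ᵐ t ∂arcMeasure, ‖boundary Φ (circleMap 0 1 t)‖ ≤ 1 := by
  filter_upwards [ae_tendsto_boundary hΦ hb] with t ht
  refine le_of_tendsto ht.norm ?_
  filter_upwards [Ioo_mem_nhdsLT (zero_lt_one' ℝ)] with r hr
    using hb _ (mul_circleMap_mem_ball hr t)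

lemma aemeasurable_boundary (hΦ : DifferentiableOn ℂ Φ (ball 0 1))
    (hb : ∀ z ∈ ball (0 : ℂ) 1, ‖Φ z‖ ≤ 1) :
    AEMeasurable (fun t ↦ boundary Φ (circleMap 0 1 t)) arcMeasure := by
  obtain ⟨u, -, hu, hut⟩ := exists_seq_strictMono_tendsto' (zero_lt_one' ℝ)
  have hu' : Tendsto u atTop (𝓝[<] 1) :=
    tendsto_nhdsWithin_iff.2 ⟨hut, Eventually.of_forall fun n ↦ (hu n).2⟩
  refine aemeasurable_of_tendsto_metrizable_ae atTop
    (fun n ↦ (continuous_radial hΦ (hu n)).measurable.aemeasurable) ?_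
  filter_upwards [ae_tendsto_boundary hΦ hb] with t ht using ht.comp hu'

/-- Radial powers converge in mean to the powers of the boundary function. -/
lemma tendsto_lintegral_norm_pow (hΦ : DifferentiableOn ℂ Φ (ball 0 1))
    (hb : ∀ z ∈ ball (0 : ℂ) 1, ‖Φ z‖ ≤ 1) {q : ℝ → ℝ≥0∞} (hq : Measurable q)
    (hqi : ∫⁻ t, q t ∂arcMeasure ≠ ∞) (n : ℕ) :
    Tendsto (fun r : ℝ ↦ ∫⁻ t, q t * ENNReal.ofReal (‖Φ (r * circleMap 0 1 t)‖ ^ n) ∂arcMeasure)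
      (𝓝[<] 1)
      (𝓝 (∫⁻ t, q t * ENNReal.ofReal (‖boundary Φ (circleMap 0 1 t)‖ ^ n) ∂arcMeasure)) := by
  apply tendsto_lintegral_filter_of_dominated_convergence q _ _ hqi
  · filter_upwards [ae_tendsto_boundary hΦ hb, ae_lt_top hq hqi] with t ht hqt
    refine ENNReal.Tendsto.const_mul ?_ (Or.inr hqt.ne)
    exact ENNReal.tendsto_ofReal (ht.norm.pow n)
  · filter_upwards [Ioo_mem_nhdsLT (zero_lt_one' ℝ)] with r hr
    exact hq.mul ((continuous_radial hΦ hr).measurable.norm.pow_const n).ennreal_ofReal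
  · filter_upwards [Ioo_mem_nhdsLT (zero_lt_one' ℝ)] with r hr
    refine Eventually.of_forall fun t ↦ mul_le_of_le_one_right' ?_
    rw [ENNReal.ofReal_le_one]
    exact pow_le_one₀ (norm_nonneg _) (hb _ (mul_circleMap_mem_ball hr t))

/-- The normalized Poisson kernel as a weight on a period of the circle. -/
noncomputable def poissonWeight (z : ℂ) (t : ℝ) : ℝ≥0∞ :=
  ENNReal.ofReal ((2 * Real.pi)⁻¹ * poissonKernel 0 z (circleMap 0 1 t))

lemma measurable_poissonWeight (z : ℂ) : Measurable (poissonWeight z) := by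
  unfold poissonWeight
  simp only [poissonKernel_def]
  fun_prop

lemma poissonKernel_nonneg {z : ℂ} (hz : ‖z‖ < 1) (t : ℝ) :
    0 ≤ poissonKernel 0 z (circleMap 0 1 t) := by
  simp only [poissonKernel_def, sub_zero, norm_circleMap_zero, abs_one]
  have : ‖z‖ ^ 2 ≤ 1 ^ 2 := by gcongr
  exact div_nonneg (by linarith) (by positivity)

lemma ofReal_circleAverage_poissonKernel_mul {z : ℂ} (hz : ‖z‖ < 1) {f : ℂ → ℝ}
    (hf : CircleIntegrable f 0 1) (h0 : ∀ t, 0 ≤ f (circleMap 0 1 t)) :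
    ENNReal.ofReal (circleAverage (fun ζ ↦ poissonKernel 0 z ζ * f ζ) 0 1)
      = ∫⁻ t, poissonWeight z t * ENNReal.ofReal (f (circleMap 0 1 t)) ∂arcMeasure := by
  have hci : CircleIntegrable (fun ζ ↦ poissonKernel 0 z ζ * f ζ) 0 1 := by
    have h1 := continuousOn_herglotzRieszKernel_sphere (c := 0) (R := 1) (w := z) (by simpa using hz)
    have h2 : ContinuousOn (poissonKernel 0 z) (sphere 0 |1|) := by
      rw [poissonKernel_eq_re_herglotzRieszKernel]
      exact continuous_re.comp_continuousOn h1
    exact hf.continuousOn_smul h2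
  rw [ofReal_circleAverage hci fun t ↦ mul_nonneg (poissonKernel_nonneg hz t) (h0 t),
    ← lintegral_const_mul' _ _ ENNReal.ofReal_ne_top]
  refine lintegral_congr fun t ↦ ?_
  rw [ENNReal.ofReal_mul (poissonKernel_nonneg hz t), ← mul_assoc, poissonWeight,
    ENNReal.ofReal_mul (by positivity)]

lemma lintegral_poissonWeight {z : ℂ} (hz : ‖z‖ < 1) :
    ∫⁻ t, poissonWeight z t ∂arcMeasure = 1 := by
  have := ofReal_circleAverage_poissonKernel_mul hz (f := fun _ ↦ 1) (circleIntegrable_const _ _ _)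
    (fun _ ↦ zero_le_one)
  simp only [mul_one, ENNReal.ofReal_one] at this
  rw [← this]
  exact (congrArg ENNReal.ofReal (circleAverage_poissonKernel (by simpa using hz))).trans
    ENNReal.ofReal_one

/-- For `r < 1` the dilate `Φ(r ·)^n` is analytic up to the circle and obeys Poisson's formula;
dominated convergence as `r → 1` carries the resulting inequality to the boundary function. -/
lemma ofReal_norm_pow_le_lintegral (hΦ : DifferentiableOn ℂ Φ (ball 0 1))
    (hb : ∀ z ∈ ball (0 : ℂ) 1, ‖Φ z‖ ≤ 1) {z : ℂ} (hz : ‖z‖ < 1) (n : ℕ) :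
    ENNReal.ofReal (‖Φ z‖ ^ n) ≤ ∫⁻ t, poissonWeight z t
      * ENNReal.ofReal (‖boundary Φ (circleMap 0 1 t)‖ ^ n) ∂arcMeasure := by
  have hzb : z ∈ ball (0 : ℂ) 1 := by simpa using hz
  have hlim := tendsto_lintegral_norm_pow hΦ hb (measurable_poissonWeight z)
    (by rw [lintegral_poissonWeight hz]; exact ENNReal.one_ne_top) n
  have hlim2 : Tendsto (fun r : ℝ ↦ ENNReal.ofReal (‖Φ (r * z)‖ ^ n)) (𝓝[<] 1)
      (𝓝 (ENNReal.ofReal (‖Φ z‖ ^ n))) := by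
    apply ENNReal.tendsto_ofReal
    apply Tendsto.pow
    apply Tendsto.norm
    have h1 : ContinuousAt Φ z := hΦ.continuousOn.continuousAt (isOpen_ball.mem_nhds hzb)
    have h2 : Tendsto (fun r : ℝ ↦ (r : ℂ) * z) (𝓝[<] 1) (𝓝 z) := by
      have : Tendsto (fun r : ℝ ↦ (r : ℂ) * z) (𝓝 1) (𝓝 (((1 : ℝ) : ℂ) * z)) :=
        Continuous.tendsto (by fun_prop) 1
      rw [ofReal_one, one_mul] at this
      exact this.mono_left nhdsWithin_le_nhds
    exact h1.tendsto.comp h2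
  refine le_of_tendsto_of_tendsto hlim2 hlim ?_
  filter_upwards [Ioo_mem_nhdsLT (zero_lt_one' ℝ)] with r hr
  have hmaps : ∀ w ∈ closedBall (0 : ℂ) 1, (r : ℂ) * w ∈ ball (0 : ℂ) 1 := by
    intro w hw
    have hw1 : ‖w‖ ≤ 1 := by simpa using hw
    rw [mem_ball_zero_iff, norm_mul, norm_real, Real.norm_of_nonneg hr.1.le]
    exact (mul_le_of_le_one_right hr.1.le hw1).trans_lt hr.2
  have hd : DiffContOnCl ℂ (fun w ↦ Φ (r * w) ^ n) (ball 0 1) := by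
    apply DifferentiableOn.diffContOnCl
    rw [closure_ball _ one_ne_zero]
    exact (hΦ.comp (by fun_prop) hmaps).pow n
  have hP := hd.circleAverage_poissonKernel_smul hzb
  have hcont : ContinuousOn (fun w ↦ ‖Φ (r * w)‖ ^ n) (closedBall 0 1) :=
    ((hΦ.continuousOn.comp (by fun_prop) hmaps).norm).pow n
  have hci : CircleIntegrable (fun w ↦ ‖Φ (r * w)‖ ^ n) 0 1 :=
    (hcont.mono sphere_subset_closedBall).circleIntegrable zero_le_one
  have h3 := ofReal_circleAverage_poissonKernel_mul hz hci (fun t ↦ by positivity)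
  rw [← h3]
  apply ENNReal.ofReal_le_ofReal
  rw [← norm_pow, ← hP]
  apply norm_circleAverage_le
  · have h1 := continuousOn_herglotzRieszKernel_sphere (c := 0) (R := 1) (w := z) hzb
    have h2 : ContinuousOn (poissonKernel 0 z) (sphere 0 |1|) := by
      rw [poissonKernel_eq_re_herglotzRieszKernel]
      exact continuous_re.comp_continuousOn h1
    exact hci.continuousOn_smul h2
  · intro w hw
    have hP0 : 0 ≤ poissonKernel 0 z w := by
      simp only [poissonKernel_def, sub_zero, hw]
      have : ‖z‖ ^ 2 ≤ 1 ^ 2 := by gcongr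
      exact div_nonneg (by linarith) (by positivity)
    simp only [Pi.smul_apply', norm_smul, Real.norm_of_nonneg hP0, norm_pow]
    exact le_rfl

/-- The subharmonic function `log (1 / (1 - |Φ|))` is dominated by the Poisson integral of its
boundary values. -/
lemma logSeries_le_lintegral (hΦ : DifferentiableOn ℂ Φ (ball 0 1))
    (hb : ∀ z ∈ ball (0 : ℂ) 1, ‖Φ z‖ ≤ 1) {z : ℂ} (hz : ‖z‖ < 1) :
    logSeries ‖Φ z‖ ≤ ∫⁻ t, poissonWeight z t
      * logSeries ‖boundary Φ (circleMap 0 1 t)‖ ∂arcMeasure := by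
  have hmeas := aemeasurable_boundary hΦ hb
  have hpw := measurable_poissonWeight z
  have hterm : ∀ (x : ℝ) (n : ℕ), 0 ≤ x → ENNReal.ofReal (x ^ (n + 1) / (n + 1))
      = ENNReal.ofReal (1 / (n + 1)) * ENNReal.ofReal (x ^ (n + 1)) := by
    intro x n hx
    rw [← ENNReal.ofReal_mul (by positivity)]
    congr 1
    ring
  -- All coefficients of the logarithmic series are positive, so subharmonicity of each power
  -- `|Φ|^(n+1)` is enough, summed term by term.
  calc logSeries ‖Φ z‖ ≤ ∑' n : ℕ, ∫⁻ t, poissonWeight z t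
        * ENNReal.ofReal (‖boundary Φ (circleMap 0 1 t)‖ ^ (n + 1) / (n + 1)) ∂arcMeasure := by
        refine ENNReal.tsum_le_tsum fun n ↦ ?_
        rw [hterm _ _ (norm_nonneg _)]
        simp_rw [hterm _ _ (norm_nonneg (boundary Φ _)), mul_left_comm (poissonWeight z _)]
        rw [lintegral_const_mul' _ _ ENNReal.ofReal_ne_top]
        gcongr
        exact ofReal_norm_pow_le_lintegral hΦ hb hz (n + 1)
    _ = _ := by
        rw [← lintegral_tsum (fun n ↦ by fun_prop)]
        simp_rw [ENNReal.tsum_mul_left]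
        rfl

end Boundary

/-! ### Construction of the outer weight -/

/-- A function with finite integral has a majorant of faster growth with finite integral. -/
lemma exists_superlinear_majorant {α : Type*} [MeasurableSpace α] {μ : Measure α} {u : α → ℝ≥0∞}
    (hu : AEMeasurable u μ) (hui : ∫⁻ x, u x ∂μ ≠ ∞) :
    ∃ H : ℝ≥0∞ → ℝ≥0∞, Measurable H ∧ ∫⁻ x, H (u x) ∂μ ≠ ∞ ∧
      ∀ k : ℕ, ∃ C : NNReal, ∀ x, k * x ≤ H x + C := by
  have htend : Tendsto (fun n : ℕ ↦ ∫⁻ x, (u x - n) ∂μ) atTop (𝓝 0) := by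
    have := tendsto_lintegral_of_dominated_convergence' (μ := μ) (F := fun (n : ℕ) x ↦ u x - n)
      (f := fun _ ↦ 0) u (fun n ↦ by fun_prop)
      (fun n ↦ Eventually.of_forall fun x ↦ tsub_le_self) hui (by
        filter_upwards [ae_lt_top' hu hui] with x hx
        obtain ⟨N, hN⟩ := ENNReal.exists_nat_gt hx.ne
        refine tendsto_const_nhds.congr' ?_
        filter_upwards [eventually_ge_atTop N] with n hn
        refine (tsub_eq_zero_of_le (hN.le.trans ?_)).symm
        exact_mod_cast hn)
    simpa using this
  have hj : ∀ j : ℕ, ∃ a : ℕ, ∫⁻ x, (u x - a) ∂μ < (2⁻¹ : ℝ≥0∞) ^ j := by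
    intro j
    exact (htend.eventually_lt_const (ENNReal.pow_pos (by simp) j)).exists
  choose a ha using hj
  -- The truncated excesses over `a j` have integrals below `2^(-j)`, so their sum is integrable;
  -- its first `k` terms already give slope `k`, up to the constant `a 0 + … + a (k - 1)`.
  refine ⟨fun x ↦ ∑' j, (x - a j), by fun_prop, ?_, fun k ↦ ?_⟩
  · rw [lintegral_tsum (fun j ↦ by fun_prop)]
    refine ne_top_of_le_ne_top ?_ (ENNReal.tsum_le_tsum fun j ↦ (ha j).le)
    rw [ENNReal.tsum_geometric]
    simp
  · refine ⟨∑ j ∈ Finset.range k, (a j : NNReal), fun x ↦ ?_⟩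
    calc (k : ℝ≥0∞) * x = ∑ _j ∈ Finset.range k, x := by simp
      _ ≤ ∑ j ∈ Finset.range k, ((x - a j) + a j) := Finset.sum_le_sum fun j _ ↦ le_tsub_add
      _ = ∑ j ∈ Finset.range k, (x - a j) + ∑ j ∈ Finset.range k, (a j : ℝ≥0∞) :=
        Finset.sum_add_distrib
      _ ≤ _ := by
        push_cast
        gcongr
        exact ENNReal.sum_le_tsum _

lemma norm_toPlane_coe_lt (φ : 𝔻 → 𝔻) {z : ℂ} (hz : z ∈ ball (0 : ℂ) 1) :
    ‖toPlane (fun z ↦ (φ z : ℂ)) z‖ < 1 := by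
  rw [toPlane_of_norm_lt _ (by simpa using hz)]
  exact (φ _).norm_lt_one

lemma logIntegral_lt_top_iff {φ : 𝔻 → 𝔻} (hφ : IsSymbol φ) :
    logIntegral φ < ∞ ↔
      ∫⁻ t, logSeries ‖boundary (toPlane fun z ↦ (φ z : ℂ)) (circleMap 0 1 t)‖ ∂arcMeasure < ∞ := by
  have h1 : logIntegral φ = (ENNReal.ofReal (2 * Real.pi))⁻¹ *
      ∫⁻ t, logSeries ‖boundary (toPlane fun z ↦ (φ z : ℂ)) (circleMap 0 1 t)‖ ∂arcMeasure := by
    rw [logIntegral]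
    congr 1
    refine lintegral_congr_ae ?_
    filter_upwards [ae_norm_boundary_le hφ fun z hz ↦ (norm_toPlane_coe_lt φ hz).le] with t ht
    rw [radialLimit_exp, toENNReal_log_eq_logSeries (norm_nonneg _) ht]
  have h2 : (ENNReal.ofReal (2 * Real.pi))⁻¹ ≠ ∞ := by
    rw [Ne, ENNReal.inv_eq_top, ENNReal.ofReal_eq_zero, not_le]
    exact Real.two_pi_pos
  have h3 : (ENNReal.ofReal (2 * Real.pi))⁻¹ ≠ 0 := ENNReal.inv_ne_zero.2 ENNReal.ofReal_ne_top
  rw [h1, lt_top_iff_ne_top, lt_top_iff_ne_top, not_iff_not, ENNReal.mul_eq_top]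
  simp only [h2, h3, ne_eq, not_false_eq_true, true_and, false_and, or_false]

/-- If `log (1 / (1 - |φ*|))` is integrable then there is an outer function that is smaller than
every power of `1 - |φ|`. -/
theorem exists_outer {φ : 𝔻 → 𝔻} (hφ : IsSymbol φ) (hlog : logIntegral φ < ∞) :
    ∃ w : 𝔻 → ℂ, IsAnalytic w ∧ (∀ z, ‖w z‖ ≤ 1) ∧ (∀ z, w z ≠ 0) ∧
      ∀ k : ℕ, ∃ C : ℝ, 0 ≤ C ∧ ∀ z, ‖w z‖ ≤ C * (1 - ‖(φ z : ℂ)‖) ^ k := by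
  set Φ := toPlane fun z ↦ (φ z : ℂ) with hΦdef
  have hb : ∀ z ∈ ball (0 : ℂ) 1, ‖Φ z‖ ≤ 1 := fun z hz ↦ (norm_toPlane_coe_lt φ hz).le
  rw [logIntegral_lt_top_iff hφ] at hlog
  set u : ℝ → ℝ≥0∞ := fun t ↦ logSeries ‖boundary Φ (circleMap 0 1 t)‖ with hu
  have hmeas : AEMeasurable u arcMeasure :=
    measurable_logSeries.comp_aemeasurable (aemeasurable_boundary hφ hb).norm
  obtain ⟨H, hH, hHi, hHk⟩ := exists_superlinear_majorant hmeas hlog.ne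
  set h : ℂ → ℝ := fun ζ ↦ (H (logSeries ‖boundary Φ ζ‖)).toReal with hh
  have hHae : ∀ᵐ t ∂arcMeasure, ENNReal.ofReal (h (circleMap 0 1 t)) = H (u t) := by
    filter_upwards [ae_lt_top' (hH.comp_aemeasurable hmeas) hHi] with t ht
    exact ENNReal.ofReal_toReal ht.ne
  have hci : CircleIntegrable h 0 1 := by
    rw [circleIntegrable_iff_integrable]
    exact integrable_toReal_of_lintegral_ne_top (hH.comp_aemeasurable hmeas) hHi
  have hciC : CircleIntegrable (fun ζ ↦ (h ζ : ℂ)) 0 1 := by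
    simp only [CircleIntegrable, intervalIntegrable_iff] at hci ⊢
    exact Complex.ofRealCLM.integrable_comp hci
  -- The real part of this Herglotz integral is the Poisson integral of `H ∘ u`, which is
  -- nonnegative, so `exp (-G)` is bounded by 1.
  set G : ℂ → ℂ := fun z ↦ circleAverage (fun ζ ↦ herglotzRieszKernel 0 z ζ • (h ζ : ℂ)) 0 1 with hG
  have hGd : DifferentiableOn ℂ G (ball 0 1) :=
    differentiableOn_circleAverage_herglotzRieszKernel_smul hciC
  have hGre : ∀ z : ℂ, ‖z‖ < 1 →
      (G z).re = circleAverage (fun ζ ↦ poissonKernel 0 z ζ * h ζ) 0 1 := by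
    intro z hz
    rw [hG, re_circleAverage_herglotzRieszKernel_smul hci (by simpa using hz),
      ← poissonKernel_eq_re_herglotzRieszKernel]
    rfl
  have hGnn : ∀ z : ℂ, ‖z‖ < 1 → 0 ≤ (G z).re := by
    intro z hz
    rw [hGre z hz, circleAverage_eq_integral_arcMeasure]
    refine mul_nonneg (by positivity) (integral_nonneg fun t ↦ ?_)
    exact mul_nonneg (poissonKernel_nonneg hz t) ENNReal.toReal_nonneg
  have hGofReal : ∀ z : ℂ, ‖z‖ < 1 →
      ENNReal.ofReal (G z).re = ∫⁻ t, poissonWeight z t * H (u t) ∂arcMeasure := by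
    intro z hz
    rw [hGre z hz, ofReal_circleAverage_poissonKernel_mul hz hci fun t ↦ ENNReal.toReal_nonneg]
    refine lintegral_congr_ae ?_
    filter_upwards [hHae] with t ht
    rw [ht]
  have hnorm : ∀ z : 𝔻, ‖exp (-G z)‖ = Real.exp (-(G z).re) := fun z ↦ by
    rw [norm_exp, neg_re]
  refine ⟨fun z ↦ exp (-G z), ?_, fun z ↦ ?_, fun z ↦ exp_ne_zero _, fun k ↦ ?_⟩
  · refine (hGd.neg.cexp).congr fun z hz ↦ ?_
    rw [toPlane_of_norm_lt _ (by simpa using hz), coe_mk]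
    rfl
  · rw [hnorm, Real.exp_le_one_iff]
    linarith [hGnn z z.norm_lt_one]
  · obtain ⟨C, hC⟩ := hHk k
    refine ⟨Real.exp C, (Real.exp_pos _).le, fun z ↦ ?_⟩
    have hz := z.norm_lt_one
    set x := ‖(φ z : ℂ)‖ with hx
    have hx1 : x < 1 := (φ z).norm_lt_one
    have hΦz : ‖Φ z‖ = x := by rw [hΦdef, toPlane_coe]
    -- Pass to the Poisson integral of `u`, then apply `k u ≤ H(u) + C` under it; the constant
    -- survives unchanged since the Poisson kernel has mass 1.
    have h1 : (k : ℝ≥0∞) * logSeries x ≤ ENNReal.ofReal (G z).re + C := by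
      rw [hGofReal z hz]
      calc (k : ℝ≥0∞) * logSeries x
          ≤ k * ∫⁻ t, poissonWeight z t * u t ∂arcMeasure := by
            rw [← hΦz]
            gcongr
            exact logSeries_le_lintegral hφ hb hz
        _ = ∫⁻ t, poissonWeight z t * (k * u t) ∂arcMeasure := by
            rw [← lintegral_const_mul' _ _ (ENNReal.natCast_ne_top k)]
            simp_rw [mul_left_comm]
        _ ≤ ∫⁻ t, (poissonWeight z t * H (u t) + poissonWeight z t * C) ∂arcMeasure := by
            refine lintegral_mono fun t ↦ ?_
            rw [← mul_add]
            gcongr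
            exact hC _
        _ = _ := by
            rw [lintegral_add_right _ ((measurable_poissonWeight z).mul_const _),
              lintegral_mul_const _ (measurable_poissonWeight z), lintegral_poissonWeight hz,
              one_mul]
    rw [logSeries_eq_ofReal (norm_nonneg _) hx1] at h1
    have hlog0 : 0 ≤ -Real.log (1 - x) := by
      have := Real.log_nonpos (x := 1 - x) (by linarith) (by linarith [norm_nonneg (φ z : ℂ)])
      linarith
    have h2 : k * (-Real.log (1 - x)) ≤ (G z).re + C := by
      rw [← ENNReal.ofReal_natCast, ← ENNReal.ofReal_mul (by positivity),
        ← ENNReal.ofReal_coe_nnreal, ← ENNReal.ofReal_add (hGnn z hz) C.coe_nonneg] at h1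
      exact (ENNReal.ofReal_le_ofReal_iff (add_nonneg (hGnn z hz) C.coe_nonneg)).1 h1
    have h3 : (1 - x) ^ k = Real.exp (k * Real.log (1 - x)) := by
      rw [Real.exp_nat_mul, Real.exp_log (by linarith)]
    rw [hnorm, h3, ← Real.exp_add]
    apply Real.exp_le_exp.2
    linarith

end WeightedComposition

/-! ### Sufficiency: rapidly decaying images of monomials -/

namespace WeightedComposition
open HardyTwo

/-- Split the exponent into `k` blocks of length `n = ⌊m / k⌋`. Each block satisfies `(1 - x) x^n ≤
1 / (n + 1)`, because `(n + 1) x^n` is at most the geometric sum; and `(n + 1) k ≥ m + 1`. -/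
lemma one_sub_pow_mul_pow_le {x : ℝ} (h0 : 0 ≤ x) (h1 : x ≤ 1) {k : ℕ} (hk : 0 < k) (m : ℕ) :
    (1 - x) ^ k * x ^ m ≤ (k / (m + 1)) ^ k := by
  set n := m / k with hn
  have hnk : n * k ≤ m := Nat.div_mul_le_self m k
  have hnk' : m + 1 ≤ (n + 1) * k := by
    have := Nat.lt_div_mul_add hk (a := m)
    rw [add_mul, one_mul, hn]
    omega
  have h2 : (1 - x) * x ^ n ≤ 1 / (n + 1) := by
    rw [le_div_iff₀ (by positivity)]
    have h3 : ∑ _j ∈ Finset.range (n + 1), x ^ n ≤ ∑ j ∈ Finset.range (n + 1), x ^ j :=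
      Finset.sum_le_sum fun j hj ↦ pow_le_pow_of_le_one h0 h1
        (Nat.lt_succ_iff.1 (Finset.mem_range.1 hj))
    rw [Finset.sum_const, Finset.card_range, nsmul_eq_mul] at h3
    have h4 := mul_neg_geom_sum x (n + 1)
    have h5 := mul_le_mul_of_nonneg_left h3 (sub_nonneg.2 h1)
    have h6 : 0 ≤ x ^ (n + 1) := by positivity
    push_cast at h5
    nlinarith
  have h7 : (1 : ℝ) / (n + 1) ≤ k / (m + 1) := by
    rw [div_le_div_iff₀ (by positivity) (by positivity), one_mul, mul_comm]
    exact_mod_cast hnk'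
  have h8 : 0 ≤ 1 - x := sub_nonneg.2 h1
  calc (1 - x) ^ k * x ^ m ≤ (1 - x) ^ k * x ^ (n * k) := by
        exact mul_le_mul_of_nonneg_left (pow_le_pow_of_le_one h0 h1 hnk) (by positivity)
    _ = ((1 - x) * x ^ n) ^ k := by rw [mul_pow, pow_mul]
    _ ≤ (k / (m + 1)) ^ k := by
        gcongr
        exact h2.trans h7

/-- Operators sending the monomials to rapidly decreasing vectors are in all Schatten classes. -/
theorem exists_isSchatten_of_rapid_decay {g : ℕ → HardyTwo}
    (hg : ∀ k : ℕ, ∃ C : ℝ, 0 ≤ C ∧ ∀ m : ℕ, ‖g m‖ ≤ C / ((m : ℝ) + 1) ^ k) :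
    ∃ T : HardyTwo →L[ℂ] HardyTwo, (∀ f, HasSum (fun n ↦ coeff f n • g n) (T f)) ∧
      ∀ p : ℝ, 0 < p → IsSchatten p T := by
  have hs2 : Summable fun n : ℕ ↦ 1 / ((n : ℝ) + 1) ^ 2 := by
    have := (summable_nat_add_iff 1).2 (Real.summable_one_div_nat_pow.2 one_lt_two)
    exact_mod_cast this
  have hgs : Summable fun n ↦ ‖g n‖ := by
    obtain ⟨C, hC0, hC⟩ := hg 2
    refine Summable.of_nonneg_of_le (fun _ ↦ norm_nonneg _) hC ?_
    simpa [div_eq_mul_inv] using hs2.mul_left C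
  set R : ℕ → HardyTwo →L[ℂ] HardyTwo := fun n ↦ (innerSL ℂ (monomialBasis n)).smulRight (g n)
    with hR
  have hRn : ∀ n, ‖R n‖ = ‖g n‖ := by
    intro n
    rw [hR, ContinuousLinearMap.norm_smulRight_apply, innerSL_apply_norm,
      monomialBasis.orthonormal.1 n, one_mul]
  have hRf : ∀ n f, R n f = coeff f n • g n := by
    intro n f
    rw [coeff_eq_inner]
    rfl
  have hRs : Summable R := Summable.of_norm (by simpa only [hRn] using hgs)
  set T := ∑' n, R n with hT
  have hTf : ∀ f, HasSum (fun n ↦ coeff f n • g n) (T f) := by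
    intro f
    have := hRs.hasSum.mapL (ContinuousLinearMap.apply ℂ HardyTwo f)
    simpa only [ContinuousLinearMap.apply_apply, hRf] using this
  refine ⟨T, hTf, fun p hp ↦ ⟨?_, ?_⟩⟩
  · refine isCompactOperator_of_tendsto (l := atTop) hRs.hasSum.tendsto_sum_nat
      (Eventually.of_forall fun N ↦ ?_)
    have : (∑ n ∈ Finset.range N, R n) ∈ compactOperator (RingHom.id ℂ) HardyTwo HardyTwo := by
      refine Submodule.sum_mem _ fun n _ ↦ ?_
      have h1 : IsCompactOperator (innerSL ℂ (monomialBasis n)) :=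
        isCompactOperator_of_locallyCompactSpace_dom
        (innerSL ℂ (monomialBasis n))
      exact h1.clm_comp (ContinuousLinearMap.toSpanSingleton ℂ (g n))
    exact this
  -- Decay of order `k + 2` is split: two powers make the tail over `n ≥ m` summable, and the other
  -- `k` give the rate `m^(-k)` of the tail norm, whose `p`th power is summable as `k p > 1`.
  · obtain ⟨k, hk⟩ := exists_nat_gt (1 / p)
    obtain ⟨C, hC0, hC⟩ := hg (k + 2)
    set K := C * ∑' n : ℕ, 1 / ((n : ℝ) + 1) ^ 2 with hK
    have hK0 : 0 ≤ K := mul_nonneg hC0 (tsum_nonneg fun n ↦ by positivity)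
    refine lt_of_le_of_lt (singularSum_le (e := monomialBasis)
      (c := fun m ↦ K / ((m : ℝ) + 1) ^ k) (fun m ↦ by positivity) ?_ hp) ?_
    · intro m x hx
      have hsx := hTf x
      rw [← hsx.tsum_eq]
      have hterm : ∀ n, ‖coeff x n • g n‖
          ≤ ‖x‖ * (C / ((m : ℝ) + 1) ^ k * (1 / ((n : ℝ) + 1) ^ 2)) := by
        intro n
        rw [norm_smul]
        by_cases hn : n < m
        · rw [coeff_eq_inner, hx n hn, norm_zero, zero_mul]
          positivity
        · have h1 : ‖coeff x n‖ ≤ ‖x‖ := by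
            rw [coeff_eq_inner]
            refine (norm_inner_le_norm _ _).trans ?_
            rw [monomialBasis.orthonormal.1 n, one_mul]
          gcongr
          refine (hC n).trans ?_
          rw [pow_add, ← div_div, div_eq_mul_one_div _ (((n : ℝ) + 1) ^ 2)]
          have : (m : ℝ) ≤ n := by exact_mod_cast not_lt.1 hn
          gcongr
      have hsum : Summable fun n : ℕ ↦ ‖x‖ * (C / ((m : ℝ) + 1) ^ k * (1 / ((n : ℝ) + 1) ^ 2)) :=
        (hs2.mul_left _).mul_left _
      refine (tsum_of_norm_bounded hsum.hasSum hterm).trans (le_of_eq ?_)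
      rw [tsum_mul_left, tsum_mul_left, hK]
      ring
    · have hkp : 1 < k * p := by
        rwa [div_lt_iff₀ hp] at hk
      have hsum : Summable fun m : ℕ ↦ (K / ((m : ℝ) + 1) ^ k) ^ p := by
        have h1 := (summable_nat_add_iff 1).2 (Real.summable_one_div_nat_rpow.2 hkp)
        refine (h1.mul_left (K ^ p)).congr fun m ↦ ?_
        rw [Real.div_rpow hK0 (by positivity), ← Real.rpow_natCast, ← Real.rpow_mul (by positivity)]
        push_cast
        ring
      rw [← ENNReal.ofReal_tsum_of_nonneg (fun m ↦ by positivity) hsum]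
      exact ENNReal.ofReal_lt_top

/-- If the weight is smaller than every power of `1 - |φ|` then the weighted composition operator
is in all Schatten classes. -/
theorem memSchatten_of_le_pow {φ : 𝔻 → 𝔻} (hφ : IsSymbol φ) {w : 𝔻 → ℂ} (hw : IsAnalytic w)
    (hk : ∀ k : ℕ, ∃ C : ℝ, 0 ≤ C ∧ ∀ z, ‖w z‖ ≤ C * (1 - ‖(φ z : ℂ)‖) ^ k) {p : ℝ} (hp : 0 < p) :
    WeightedCompMemSchatten p w φ := by
  have hbound : ∀ k : ℕ, ∃ C : ℝ, 0 ≤ C ∧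
      ∀ (m : ℕ) (z : 𝔻), ‖w z * (φ z : ℂ) ^ m‖ ≤ C / ((m : ℝ) + 1) ^ k := by
    intro k
    rcases Nat.eq_zero_or_pos k with rfl | hk0
    · obtain ⟨C, hC0, hC⟩ := hk 0
      refine ⟨C, hC0, fun m z ↦ ?_⟩
      have h1 := hC z
      rw [pow_zero, mul_one] at h1
      rw [pow_zero, div_one, norm_mul, norm_pow]
      exact (mul_le_of_le_one_right (norm_nonneg _)
        (pow_le_one₀ (norm_nonneg _) (φ z).norm_lt_one.le)).trans h1
    · obtain ⟨C, hC0, hC⟩ := hk k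
      refine ⟨C * (k : ℝ) ^ k, by positivity, fun m z ↦ ?_⟩
      rw [norm_mul, norm_pow]
      calc ‖w z‖ * ‖(φ z : ℂ)‖ ^ m
          ≤ C * (1 - ‖(φ z : ℂ)‖) ^ k * ‖(φ z : ℂ)‖ ^ m := by gcongr; exact hC z
        _ = C * ((1 - ‖(φ z : ℂ)‖) ^ k * ‖(φ z : ℂ)‖ ^ m) := by ring
        _ ≤ C * (k / ((m : ℝ) + 1)) ^ k := by
            gcongr
            exact one_sub_pow_mul_pow_le (norm_nonneg _) (φ z).norm_lt_one.le hk0 m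
        _ = C * (k : ℝ) ^ k / ((m : ℝ) + 1) ^ k := by rw [div_pow]; ring
  have hana : ∀ m : ℕ, IsAnalytic fun z ↦ w z * (φ z : ℂ) ^ m := by
    intro m
    refine (DifferentiableOn.mul hw (DifferentiableOn.pow hφ m)).congr fun z hz ↦ ?_
    have hz1 : ‖z‖ < 1 := by simpa using hz
    simp only [toPlane_of_norm_lt _ hz1, Pi.mul_apply, Pi.pow_apply]
  -- The norm estimate is quantified over every sup bound `B`, so that one choice of `g m` serves
  -- all decay orders `k`.
  have hex : ∀ m : ℕ, ∃ g : HardyTwo, (∀ z, g z = w z * (φ z : ℂ) ^ m) ∧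
      ∀ B : ℝ, 0 ≤ B → (∀ z, ‖w z * (φ z : ℂ) ^ m‖ ≤ B) → ‖g‖ ≤ B := by
    intro m
    obtain ⟨C, hC0, hC⟩ := hbound 0
    obtain ⟨g, hg, -⟩ := exists_of_bounded (hana m) (by positivity) (hC m)
    refine ⟨g, hg, fun B hB0 hB ↦ ?_⟩
    obtain ⟨g', hg', hg'B⟩ := exists_of_bounded (hana m) hB0 hB
    have : g = g' := RKHS.ext fun z ↦ by rw [hg, hg']
    rwa [this]
  choose g hg hgB using hex
  obtain ⟨T, hTf, hTS⟩ := exists_isSchatten_of_rapid_decay (g := g) fun k ↦ by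
    obtain ⟨C, hC0, hC⟩ := hbound k
    exact ⟨C, hC0, fun m ↦ hgB m _ (by positivity) (hC m)⟩
  refine ⟨T, fun f z ↦ ?_, hTS p hp⟩
  have h1 : HasSum (fun n ↦ coeff f n * (w z * (φ z : ℂ) ^ n)) (T f z) := by
    have h2 := (hTf f).mapL (evalCLM z)
    have h3 : ∀ n, evalCLM z (coeff f n • g n) = coeff f n * (w z * (φ z : ℂ) ^ n) := fun n ↦ by
      rw [map_smul, smul_eq_mul, ← hg n z]
      rfl
    simp only [h3] at h2
    exact h2
  have h2 := (hasSum_coeff f (φ z)).mul_left (w z)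
  simp only [mul_left_comm (w z)] at h2
  exact h1.unique h2

end WeightedComposition

/-! ### Necessity: from Schatten decay to logarithmic integrability -/

namespace WeightedComposition
open Real (circleAverage)
open Metric HardyTwo

lemma sum_ite_lt_le_one_add_log {M : ℝ} (hM : 1 ≤ M) (N : ℕ) :
    ∑ n ∈ Finset.range N, (if (n : ℝ) + 1 < M then 1 / ((n : ℝ) + 1) else 0) ≤ 1 + Real.log M := by
  refine le_trans ?_ (harmonic_floor_le_one_add_log M hM)
  rw [harmonic, Rat.cast_sum, ← Finset.sum_filter]
  have hsub : (Finset.range N).filter (fun n : ℕ ↦ (n : ℝ) + 1 < M) ⊆ Finset.range ⌊M⌋₊ := by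
    intro n hn
    rw [Finset.mem_range, ← Nat.succ_le_iff, Nat.le_floor_iff (by linarith)]
    push_cast
    exact (Finset.mem_filter.1 hn).2.le
  refine (Finset.sum_le_sum_of_subset_of_nonneg hsub fun _ _ _ ↦ by positivity).trans (le_of_eq ?_)
  refine Finset.sum_congr rfl fun n _ ↦ ?_
  push_cast
  rw [one_div]

/-- Comparison of the logarithmic series with a weighted power series. -/
lemma sum_pow_div_le {y a γ : ℝ} (h0 : 0 ≤ y) (h1 : y ≤ 1) (ha : 0 < a) (hγ : 0 < γ) (N : ℕ) :
    ∑ n ∈ Finset.range N, y ^ (n + 1) / ((n : ℝ) + 1)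
      ≤ ∑ n ∈ Finset.range N, ((n : ℝ) + 1) ^ (γ / 2 - 1) * (a ^ 2 * y ^ (n + 1))
        + (1 + 4 / γ * (a ^ 2 - Real.log a)) := by
  -- From `n + 1 ≥ M` on, `(n + 1) ^ (γ / 2) * a ^ 2 ≥ 1` and the weighted term dominates. The terms
  -- below `M` cost at most `1 + log M = 1 - (4 / γ) log a`; the extra `a ^ 2` keeps the bound
  -- nonnegative when `M < 1`.
  set M : ℝ := a ^ (-(4 / γ)) with hM
  have hM0 : 0 < M := Real.rpow_pos_of_pos ha _
  have hterm : ∀ n : ℕ, y ^ (n + 1) / ((n : ℝ) + 1)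
      ≤ ((n : ℝ) + 1) ^ (γ / 2 - 1) * (a ^ 2 * y ^ (n + 1))
        + if (n : ℝ) + 1 < M then 1 / ((n : ℝ) + 1) else 0 := by
    intro n
    have hn : (0 : ℝ) < (n : ℝ) + 1 := by positivity
    have hy : y ^ (n + 1) ≤ 1 := pow_le_one₀ h0 h1
    have hy0 : 0 ≤ y ^ (n + 1) := pow_nonneg h0 _
    split_ifs with h
    · have h2 : 0 ≤ ((n : ℝ) + 1) ^ (γ / 2 - 1) * (a ^ 2 * y ^ (n + 1)) := by positivity
      have h3 : y ^ (n + 1) / ((n : ℝ) + 1) ≤ 1 / ((n : ℝ) + 1) := by gcongr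
      linarith
    · rw [not_lt] at h
      have h2 : M ^ (γ / 2) ≤ ((n : ℝ) + 1) ^ (γ / 2) := by gcongr
      have h3 : M ^ (γ / 2) = (a ^ 2)⁻¹ := by
        rw [hM, ← Real.rpow_mul ha.le, ← Real.rpow_natCast, ← Real.rpow_neg ha.le]
        congr 1
        push_cast
        field_simp
        norm_num
      rw [h3, inv_le_iff_one_le_mul₀ (by positivity)] at h2
      rw [add_zero, Real.rpow_sub hn, Real.rpow_one]
      calc y ^ (n + 1) / ((n : ℝ) + 1) = 1 * (y ^ (n + 1) / ((n : ℝ) + 1)) := (one_mul _).symm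
        _ ≤ (((n : ℝ) + 1) ^ (γ / 2) * a ^ 2) * (y ^ (n + 1) / ((n : ℝ) + 1)) := by gcongr
        _ = _ := by ring
  refine (Finset.sum_le_sum fun n _ ↦ hterm n).trans ?_
  rw [Finset.sum_add_distrib]
  gcongr
  have hloga : Real.log a ≤ a ^ 2 := by
    have := Real.log_le_sub_one_of_pos ha
    nlinarith [sq_nonneg (a - 1)]
  rcases le_or_gt 1 M with h | h
  · refine (sum_ite_lt_le_one_add_log h N).trans ?_
    rw [hM, Real.log_rpow ha]
    have h2 : 0 ≤ 4 / γ * a ^ 2 := by positivity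
    linarith
  · have h3 : ∑ n ∈ Finset.range N, (if (n : ℝ) + 1 < M then 1 / ((n : ℝ) + 1) else 0) = 0 := by
      refine Finset.sum_eq_zero fun n _ ↦ if_neg ?_
      have : (0 : ℝ) ≤ n := n.cast_nonneg
      linarith
    rw [h3]
    have : 0 ≤ 4 / γ * (a ^ 2 - Real.log a) := mul_nonneg (by positivity) (by linarith)
    linarith

/-- The pointwise comparison breaks down at zeros of `W`, where `Real.log` takes the default value
0. These zeros form a discrete set on the circle and do not affect averages. -/
lemma circleAverage_mono_of_ne_zero {W : ℂ → ℂ} {f₁ f₂ : ℂ → ℝ} {r : ℝ} (hr : r ≠ 0)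
    (hW : ∀ᶠ z in codiscreteWithin (sphere (0 : ℂ) |r|), W z ≠ 0)
    (h₁ : CircleIntegrable f₁ 0 r) (h₂ : CircleIntegrable f₂ 0 r)
    (h : ∀ z ∈ sphere (0 : ℂ) |r|, W z ≠ 0 → f₁ z ≤ f₂ z) :
    circleAverage f₁ 0 r ≤ circleAverage f₂ 0 r := by
  classical
  have hcongr : f₁ =ᶠ[codiscreteWithin (sphere (0 : ℂ) |r|)]
      fun z ↦ if W z = 0 then f₂ z else f₁ z := by
    filter_upwards [hW] with z hz
    rw [if_neg hz]
  rw [Real.circleAverage_congr_codiscreteWithin hcongr hr]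
  refine Real.circleAverage_mono (h₁.congr_codiscreteWithin hcongr) h₂ fun z hz ↦ ?_
  split_ifs with hz0
  · exact le_rfl
  · exact h z hz hz0

/-- By Jensen's formula, the circular means of `log |W|` are bounded below. -/
lemma exists_le_circleAverage_log_norm {W : ℂ → ℂ} (hW : AnalyticOnNhd ℂ W (ball 0 1)) :
    ∃ K : ℝ, ∀ r ∈ Set.Ico (1 / 2 : ℝ) 1, K ≤ circleAverage (fun z ↦ Real.log ‖W z‖) 0 r := by
  -- In Jensen's formula the zeros away from the origin contribute nonnegatively; a zero of order
  -- `d` at the origin contributes `d log r`, which is at least `-d log 2` for `r ≥ 1/2`.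
  set d : ℝ := ((meromorphicOrderAt W 0).untop₀ : ℝ) with hd
  refine ⟨d * -Real.log 2 + Real.log ‖meromorphicTrailingCoeffAt W 0‖, fun r hr ↦ ?_⟩
  have hr0 : 0 < r := by linarith [hr.1]
  have han : AnalyticOnNhd ℂ W (closedBall 0 |r|) :=
    hW.mono (closedBall_subset_ball (by rw [abs_of_pos hr0]; exact hr.2))
  have hnn : ∀ u, 0 ≤ (MeromorphicOn.divisor W (closedBall 0 |r|)) u :=
    fun u ↦ MeromorphicOn.AnalyticOnNhd.divisor_nonneg han u
  rw [han.meromorphicOn.circleAverage_log_norm hr0.ne']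
  have h0 : (0 : ℂ) ∈ closedBall (0 : ℂ) |r| := mem_closedBall_self (abs_nonneg r)
  have hdr : ((MeromorphicOn.divisor W (closedBall 0 |r|)) 0 : ℝ) = d := by
    rw [MeromorphicOn.divisor_apply han.meromorphicOn h0]
  have hd0 : 0 ≤ d := by
    rw [← hdr]
    exact_mod_cast hnn 0
  have hlog : -Real.log 2 ≤ Real.log r := by
    rw [← Real.log_inv]
    exact Real.log_le_log (by norm_num) (by linarith [hr.1])
  have hsum : 0 ≤ ∑ᶠ u, ((MeromorphicOn.divisor W (closedBall 0 |r|)) u : ℝ)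
      * Real.log (r * ‖(0 : ℂ) - u‖⁻¹) := by
    refine finsum_nonneg fun u ↦ ?_
    by_cases hu : u ∈ closedBall (0 : ℂ) |r|
    · refine mul_nonneg (by exact_mod_cast hnn u) ?_
      rcases eq_or_ne u 0 with rfl | hu0
      · simp
      · apply Real.log_nonneg
        rw [zero_sub, norm_neg, ← div_eq_mul_inv, one_le_div (norm_pos_iff.2 hu0)]
        simpa [abs_of_pos hr0] using hu
    · rw [Function.locallyFinsuppWithin.apply_eq_zero_of_notMem _ hu]
      simp
  rw [hdr]
  have := mul_le_mul_of_nonneg_left hlog hd0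
  linarith

/-- This holds because `1 - x² ≤ 2 (1 - x)`. It converts the even powers of `|Φ|` supplied by
Hilbert space norms into the required logarithm. -/
lemma logSeries_le_add_logSeries_sq {x : ℝ} (h0 : 0 ≤ x) (h1 : x ≤ 1) :
    logSeries x ≤ ENNReal.ofReal (Real.log 2) + logSeries (x ^ 2) := by
  rcases h1.lt_or_eq with h | rfl
  · have hx2 : x ^ 2 < 1 := by nlinarith
    have hlog2 : 0 ≤ -Real.log (1 - x ^ 2) := by
      have := Real.log_nonpos (x := 1 - x ^ 2) (by linarith) (by nlinarith)
      linarith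
    rw [logSeries_eq_ofReal h0 h, logSeries_eq_ofReal (by positivity) hx2,
      ← ENNReal.ofReal_add (Real.log_nonneg (by norm_num)) hlog2]
    apply ENNReal.ofReal_le_ofReal
    have h3 : (1 : ℝ) - x ^ 2 = (1 - x) * (1 + x) := by ring
    rw [h3, Real.log_mul (by linarith) (by linarith)]
    have := Real.log_le_log (x := 1 + x) (y := 2) (by linarith) (by linarith)
    linarith
  · simp [logSeries_one]

/-- If the weighted means `∫ |W|² |Φ|²ⁿ` decay polynomially then `log (1 / (1 - |Φ|²))` has bounded
circular means. -/
lemma exists_circleAverage_sum_le {W Φ : ℂ → ℂ} (hW : DifferentiableOn ℂ W (ball 0 1))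
    (hW0 : ¬ Set.EqOn W 0 (ball 0 1)) (hΦ : DifferentiableOn ℂ Φ (ball 0 1))
    (hb : ∀ z ∈ ball (0 : ℂ) 1, ‖Φ z‖ ≤ 1) {C γ B : ℝ} (hγ : 0 < γ)
    (hWB : ∀ r ∈ Set.Ioo (0 : ℝ) 1, circleAverage (fun z ↦ ‖W z‖ ^ 2) 0 r ≤ B)
    (hC : ∀ r ∈ Set.Ioo (0 : ℝ) 1, ∀ n : ℕ,
      circleAverage (fun z ↦ ‖W z‖ ^ 2 * (‖Φ z‖ ^ 2) ^ (n + 1)) 0 r ≤ C * ((n : ℝ) + 1) ^ (-γ)) :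
    ∃ K : ℝ, ∀ r ∈ Set.Ico (1 / 2 : ℝ) 1, ∀ N : ℕ,
      ∑ n ∈ Finset.range N, circleAverage (fun z ↦ (‖Φ z‖ ^ 2) ^ (n + 1)) 0 r / ((n : ℝ) + 1)
        ≤ K := by
  have hWan : AnalyticOnNhd ℂ W (ball 0 1) := hW.analyticOnNhd isOpen_ball
  obtain ⟨J, hJ⟩ := exists_le_circleAverage_log_norm hWan
  have hC0 : 0 ≤ C := by
    have h1 := hC (1 / 2) ⟨by norm_num, by norm_num⟩ 0
    simp only [Nat.cast_zero, zero_add, Real.one_rpow, mul_one] at h1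
    exact (Real.circleAverage_nonneg_of_nonneg fun z _ ↦ by positivity).trans h1
  have hsum : Summable fun n : ℕ ↦ C * ((n : ℝ) + 1) ^ (-1 - γ / 2) := by
    have h1 := (summable_nat_add_iff 1).2
      (Real.summable_one_div_nat_rpow.2 (show 1 < 1 + γ / 2 by linarith))
    refine (h1.mul_left C).congr fun n ↦ ?_
    push_cast
    rw [one_div, ← Real.rpow_neg (by positivity)]
    congr 2
    ring
  -- The weight `(n + 1) ^ (γ / 2 - 1)` times the decay `(n + 1) ^ (-γ)` has the summable exponent
  -- `-1 - γ / 2`; `B - J` bounds the mean of `‖W‖² - log ‖W‖`.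
  refine ⟨∑' n : ℕ, C * ((n : ℝ) + 1) ^ (-1 - γ / 2) + (1 + 4 / γ * (B - J)), fun r hr N ↦ ?_⟩
  have hr0 : 0 < r := by linarith [hr.1]
  have hr' : r ∈ Set.Ioo (0 : ℝ) 1 := ⟨hr0, hr.2⟩
  have hsph : sphere (0 : ℂ) |r| ⊆ ball 0 1 := by
    rw [abs_of_pos hr0]
    exact sphere_subset_closedBall.trans (closedBall_subset_ball hr.2)
  have hWne : ∀ᶠ z in codiscreteWithin (sphere (0 : ℂ) |r|), W z ≠ 0 := by
    have := (hWan.eqOn_zero_or_eventually_ne_zero_of_preconnected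
      (convex_ball (0 : ℂ) 1).isPreconnected).resolve_left hW0
    exact codiscreteWithin_mono hsph this
  have hcW : ContinuousOn (fun z ↦ ‖W z‖ ^ 2) (sphere (0 : ℂ) |r|) :=
    (hW.continuousOn.mono hsph).norm.pow 2
  have hcΦ : ∀ n : ℕ, ContinuousOn (fun z ↦ (‖Φ z‖ ^ 2) ^ (n + 1)) (sphere (0 : ℂ) |r|) :=
    fun n ↦ ((hΦ.continuousOn.mono hsph).norm.pow 2).pow (n + 1)
  have hi1 : ∀ n : ℕ, CircleIntegrable (fun z ↦ (((n : ℝ) + 1)⁻¹) • (‖Φ z‖ ^ 2) ^ (n + 1)) 0 r :=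
    fun n ↦ ContinuousOn.circleIntegrable' ((hcΦ n).fun_const_smul _)
  have hi2 : ∀ n : ℕ, CircleIntegrable (fun z ↦ (((n : ℝ) + 1) ^ (γ / 2 - 1)) •
      (‖W z‖ ^ 2 * (‖Φ z‖ ^ 2) ^ (n + 1))) 0 r :=
    fun n ↦ ContinuousOn.circleIntegrable' ((hcW.mul (hcΦ n)).fun_const_smul _)
  have hi3 : CircleIntegrable (fun z ↦ Real.log ‖W z‖) 0 r :=
    MeromorphicOn.circleIntegrable_log_norm fun z hz ↦ (hWan z (hsph hz)).meromorphicAt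
  have hi4 : CircleIntegrable (fun z ↦ ‖W z‖ ^ 2) 0 r := hcW.circleIntegrable'
  have hi5 : CircleIntegrable (fun z ↦ (4 / γ) • (‖W z‖ ^ 2 - Real.log ‖W z‖)) 0 r :=
    (hi4.sub hi3).const_smul
  have hi6 : CircleIntegrable (fun z ↦ 1 + (4 / γ) • (‖W z‖ ^ 2 - Real.log ‖W z‖)) 0 r :=
    (circleIntegrable_const (1 : ℝ) _ _).add hi5
  have hi7 : CircleIntegrable (fun z ↦ ∑ n ∈ Finset.range N, (((n : ℝ) + 1) ^ (γ / 2 - 1)) •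
      (‖W z‖ ^ 2 * (‖Φ z‖ ^ 2) ^ (n + 1))) 0 r := CircleIntegrable.fun_sum _ fun n _ ↦ hi2 n
  have hmain := circleAverage_mono_of_ne_zero (W := W) (r := r) hr0.ne' hWne
    (f₁ := fun z ↦ ∑ n ∈ Finset.range N, (((n : ℝ) + 1)⁻¹) • (‖Φ z‖ ^ 2) ^ (n + 1))
    (f₂ := fun z ↦ ∑ n ∈ Finset.range N, (((n : ℝ) + 1) ^ (γ / 2 - 1)) •
      (‖W z‖ ^ 2 * (‖Φ z‖ ^ 2) ^ (n + 1)) + (1 + (4 / γ) • (‖W z‖ ^ 2 - Real.log ‖W z‖)))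
    (CircleIntegrable.fun_sum _ fun n _ ↦ hi1 n) (hi7.add hi6) (by
      intro z hz hWz
      have := sum_pow_div_le (y := ‖Φ z‖ ^ 2) (a := ‖W z‖) (γ := γ) (by positivity)
        (pow_le_one₀ (norm_nonneg _) (hb z (hsph hz))) (norm_pos_iff.2 hWz) hγ N
      simp only [smul_eq_mul, inv_mul_eq_div]
      exact this)
  rw [Real.circleAverage_fun_sum (fun n _ ↦ hi1 n), Real.circleAverage_fun_add hi7 hi6,
    Real.circleAverage_fun_sum (fun n _ ↦ hi2 n),
    Real.circleAverage_fun_add (circleIntegrable_const (1 : ℝ) _ _) hi5,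
    Real.circleAverage_fun_smul, Real.circleAverage_fun_sub hi4 hi3, Real.circleAverage_const]
    at hmain
  simp only [Real.circleAverage_fun_smul] at hmain
  simp only [smul_eq_mul] at hmain
  simp only [div_eq_inv_mul _ ((_ : ℝ) + 1)]
  refine hmain.trans (add_le_add ?_ ?_)
  · refine le_trans (Finset.sum_le_sum fun n _ ↦ ?_)
      (hsum.sum_le_tsum (Finset.range N) fun n _ ↦ by positivity)
    have hn : (0 : ℝ) < (n : ℝ) + 1 := by positivity
    calc ((n : ℝ) + 1) ^ (γ / 2 - 1)
          * circleAverage (fun z ↦ ‖W z‖ ^ 2 * (‖Φ z‖ ^ 2) ^ (n + 1)) 0 r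
        ≤ ((n : ℝ) + 1) ^ (γ / 2 - 1) * (C * ((n : ℝ) + 1) ^ (-γ)) := by
          gcongr
          exact hC r hr' n
      _ = C * (((n : ℝ) + 1) ^ (γ / 2 - 1) * ((n : ℝ) + 1) ^ (-γ)) := by ring
      _ = C * ((n : ℝ) + 1) ^ (-1 - γ / 2) := by
          rw [← Real.rpow_add hn]
          congr 2
          ring
  · gcongr
    · exact hWB r hr'
    · exact hJ r hr

/-- Bounded circular means of `log (1 / (1 - |φ|²))` give integrability of the boundary values of
`log (1 / (1 - |φ|))`. -/
lemma logIntegral_lt_top_of_circleAverage_le {φ : 𝔻 → 𝔻} (hφ : IsSymbol φ) {K : ℝ}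
    (hK : ∀ r ∈ Set.Ico (1 / 2 : ℝ) 1, ∀ N : ℕ, ∑ n ∈ Finset.range N,
      circleAverage (fun z ↦ (‖toPlane (fun z ↦ (φ z : ℂ)) z‖ ^ 2) ^ (n + 1)) 0 r / ((n : ℝ) + 1)
        ≤ K) : logIntegral φ < ∞ := by
  rw [logIntegral_lt_top_iff hφ]
  set Φ := toPlane fun z ↦ (φ z : ℂ) with hΦdef
  have hb : ∀ z ∈ ball (0 : ℂ) 1, ‖Φ z‖ ≤ 1 := fun z hz ↦ (norm_toPlane_coe_lt φ hz).le
  have hmeas := aemeasurable_boundary hφ hb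
  set c : ℝ≥0∞ := ENNReal.ofReal (2 * Real.pi)⁻¹ with hc
  have hc0 : c ≠ 0 := by
    rw [hc, Ne, ENNReal.ofReal_eq_zero, not_le]
    exact inv_pos.2 Real.two_pi_pos
  have hpart : ∀ N : ℕ, ∑ n ∈ Finset.range N, ENNReal.ofReal (1 / ((n : ℝ) + 1)) * (c *
      ∫⁻ t, ENNReal.ofReal ((‖boundary Φ (circleMap 0 1 t)‖ ^ 2) ^ (n + 1)) ∂arcMeasure)
        ≤ ENNReal.ofReal K := by
    intro N
    -- With `N` fixed the sum is finite, so `r → 1` passes through it; `N → ∞` is taken afterwards,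
    -- by positivity of the terms.
    have hlim : Tendsto (fun r : ℝ ↦ ∑ n ∈ Finset.range N, ENNReal.ofReal (1 / ((n : ℝ) + 1)) * (c *
        ∫⁻ t, ENNReal.ofReal ((‖Φ (r * circleMap 0 1 t)‖ ^ 2) ^ (n + 1)) ∂arcMeasure)) (𝓝[<] 1)
        (𝓝 (∑ n ∈ Finset.range N, ENNReal.ofReal (1 / ((n : ℝ) + 1)) * (c *
      ∫⁻ t, ENNReal.ofReal ((‖boundary Φ (circleMap 0 1 t)‖ ^ 2) ^ (n + 1)) ∂arcMeasure))) := by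
      refine tendsto_finsetSum _ fun n _ ↦ ?_
      refine ENNReal.Tendsto.const_mul ?_ (Or.inr ENNReal.ofReal_ne_top)
      refine ENNReal.Tendsto.const_mul ?_ (Or.inr ENNReal.ofReal_ne_top)
      have := tendsto_lintegral_norm_pow hφ hb (q := fun _ ↦ 1) measurable_const
        (by simp) (2 * (n + 1))
      simpa only [one_mul, pow_mul] using this
    refine le_of_tendsto hlim ?_
    filter_upwards [Ico_mem_nhdsLT (show (1 / 2 : ℝ) < 1 by norm_num)] with r hr
    have hr0 : 0 < r := by linarith [hr.1]
    refine le_trans (le_of_eq ?_) (ENNReal.ofReal_le_ofReal (hK r hr N))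
    rw [ENNReal.ofReal_sum_of_nonneg fun n _ ↦ div_nonneg
      (Real.circleAverage_nonneg_of_nonneg fun z _ ↦ by positivity) (by positivity)]
    refine Finset.sum_congr rfl fun n _ ↦ ?_
    rw [one_div, div_eq_inv_mul, ENNReal.ofReal_mul (by positivity), ofReal_circleAverage]
    · congr 2
      refine lintegral_congr fun t ↦ ?_
      simp [circleMap]
    · apply ContinuousOn.circleIntegrable'
      have hsph : sphere (0 : ℂ) |r| ⊆ ball 0 1 := by
        rw [abs_of_pos hr0]
        exact sphere_subset_closedBall.trans (closedBall_subset_ball hr.2)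
      exact ((hφ.continuousOn.mono hsph).norm.pow 2).pow (n + 1)
    · intro t
      positivity
  have hsq : c * ∫⁻ t, logSeries (‖boundary Φ (circleMap 0 1 t)‖ ^ 2) ∂arcMeasure
      ≤ ENNReal.ofReal K := by
    have h1 : ∀ x : ℝ, 0 ≤ x → logSeries x
        = ∑' n : ℕ, ENNReal.ofReal (1 / ((n : ℝ) + 1)) * ENNReal.ofReal (x ^ (n + 1)) := by
      intro x hx
      refine tsum_congr fun n ↦ ?_
      rw [← ENNReal.ofReal_mul (by positivity)]
      congr 1
      ring
    simp_rw [h1 _ (sq_nonneg _)]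
    rw [lintegral_tsum (fun n ↦ by fun_prop), ← ENNReal.tsum_mul_left,
      ENNReal.tsum_eq_iSup_nat]
    refine iSup_le fun N ↦ le_trans (le_of_eq ?_) (hpart N)
    refine Finset.sum_congr rfl fun n _ ↦ ?_
    rw [lintegral_const_mul' _ _ ENNReal.ofReal_ne_top, mul_left_comm]
  have hsq' : ∫⁻ t, logSeries (‖boundary Φ (circleMap 0 1 t)‖ ^ 2) ∂arcMeasure ≠ ∞ := by
    intro h
    rw [h, ENNReal.mul_top hc0] at hsq
    exact ENNReal.ofReal_ne_top (top_le_iff.1 hsq)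
  calc ∫⁻ t, logSeries ‖boundary Φ (circleMap 0 1 t)‖ ∂arcMeasure
      ≤ ∫⁻ t, (ENNReal.ofReal (Real.log 2)
        + logSeries (‖boundary Φ (circleMap 0 1 t)‖ ^ 2)) ∂arcMeasure := by
        refine lintegral_mono_ae ?_
        filter_upwards [ae_norm_boundary_le hφ hb] with t ht
        exact logSeries_le_add_logSeries_sq (norm_nonneg _) ht
    _ < ∞ := by
        rw [lintegral_add_left measurable_const, lintegral_const]
        exact ENNReal.add_lt_top.2
          ⟨ENNReal.mul_lt_top ENNReal.ofReal_lt_top (measure_lt_top _ _), hsq'.lt_top⟩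

/-- A nonzero weighted composition operator of Schatten class forces `log (1 / (1 - |φ*|))` to be
integrable. -/
theorem logIntegral_lt_top_of_memSchatten {φ : 𝔻 → 𝔻} (hφ : IsSymbol φ) {w : 𝔻 → ℂ} (hw : w ≠ 0)
    {p : ℝ} (hp : 0 < p) (hT : WeightedCompMemSchatten p w φ) : logIntegral φ < ∞ := by
  obtain ⟨T, hTw, hTS⟩ := hT
  have hTn : ∀ n z, T (monomialBasis n) z = w z * (φ z : ℂ) ^ n := by
    intro n z
    rw [hTw, monomialBasis_apply]
  have hTw0 : ∀ z, T (monomialBasis 0) z = w z := by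
    intro z
    rw [hTn, pow_zero, mul_one]
  set Φ := toPlane fun z ↦ (φ z : ℂ) with hΦdef
  -- The weight is the image of the constant function 1, hence it is automatically in `H²`, and in
  -- particular analytic.
  set W := toPlane (T (monomialBasis 0)) with hWdef
  obtain ⟨C, hC0, hC⟩ := hTS.exists_sum_norm_sq_le hp monomialBasis.orthonormal
  have hTplane : ∀ n, ∀ z ∈ ball (0 : ℂ) 1, toPlane (T (monomialBasis n)) z = W z * Φ z ^ n := by
    intro n z hz
    have hz1 : ‖z‖ < 1 := by simpa using hz
    rw [hWdef, hΦdef, toPlane_of_norm_lt _ hz1, toPlane_of_norm_lt _ hz1,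
      toPlane_of_norm_lt _ hz1, hTn, hTw0]
  have hb : ∀ z ∈ ball (0 : ℂ) 1, ‖Φ z‖ ≤ 1 := fun z hz ↦ (norm_toPlane_coe_lt φ hz).le
  have hWd : DifferentiableOn ℂ W (ball 0 1) := isAnalytic _
  have hW0 : ¬ Set.EqOn W 0 (ball 0 1) := by
    intro h
    refine hw (funext fun z ↦ ?_)
    have := h (show (z : ℂ) ∈ ball (0 : ℂ) 1 by simpa using z.norm_lt_one)
    rw [hWdef, toPlane_coe, hTw0] at this
    exact this
  have hdecay : ∀ r ∈ Set.Ioo (0 : ℝ) 1, ∀ n : ℕ,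
      circleAverage (fun z ↦ ‖W z‖ ^ 2 * (‖Φ z‖ ^ 2) ^ (n + 1)) 0 r
        ≤ C * ((n : ℝ) + 1) ^ (-(2 / (p + 2))) := by
    intro r hr n
    have hsph : sphere (0 : ℂ) |r| ⊆ ball 0 1 := by
      rw [abs_of_pos hr.1]
      exact sphere_subset_closedBall.trans (closedBall_subset_ball hr.2)
    have hcont : ∀ j, ContinuousOn (fun z ↦ ‖W z‖ ^ 2 * (‖Φ z‖ ^ 2) ^ j) (sphere (0 : ℂ) |r|) :=
      fun j ↦ ((hWd.continuousOn.mono hsph).norm.pow 2).mul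
        (((DifferentiableOn.continuousOn hφ).mono hsph).norm.pow 2 |>.pow j)
    set A := circleAverage (fun z ↦ ‖W z‖ ^ 2 * (‖Φ z‖ ^ 2) ^ (n + 1)) 0 r with hA
    -- The means decrease in the exponent because `|Φ| ≤ 1`. Thus `n + 1` copies of `A` are bounded
    -- by the summed Schatten estimate, which yields decay of each individual mean with `γ = 2 / (p
    -- + 2)`.
    have hle : ∀ j ∈ Finset.range (n + 1), A ≤ ‖T (monomialBasis j)‖ ^ 2 := by
      intro j hj
      refine le_trans ?_ (circleAverage_norm_sq_le (T (monomialBasis j)) hr.1.le hr.2)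
      have h1 : circleAverage (fun z ↦ ‖toPlane (T (monomialBasis j)) z‖ ^ 2) 0 r
          = circleAverage (fun z ↦ ‖W z‖ ^ 2 * (‖Φ z‖ ^ 2) ^ j) 0 r := by
        apply Real.circleAverage_congr_sphere
        intro z hz
        simp only [hTplane j z (hsph hz), norm_mul, norm_pow, mul_pow, ← pow_mul, mul_comm]
      rw [h1]
      refine Real.circleAverage_mono (hcont _).circleIntegrable' (hcont _).circleIntegrable'
        fun z hz ↦ ?_
      have hx : ‖Φ z‖ ^ 2 ≤ 1 := pow_le_one₀ (norm_nonneg _) (hb z (hsph hz))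
      exact mul_le_mul_of_nonneg_left
        (pow_le_pow_of_le_one (by positivity) hx (Finset.mem_range.1 hj).le) (by positivity)
    have hn : (0 : ℝ) < (n : ℝ) + 1 := by positivity
    have hsum := (Finset.sum_le_sum hle).trans (hC (n + 1) n.succ_pos)
    rw [Finset.sum_const, Finset.card_range, nsmul_eq_mul] at hsum
    push_cast at hsum
    rw [Real.rpow_sub hn, Real.rpow_one] at hsum
    rw [Real.rpow_neg hn.le]
    refine le_of_mul_le_mul_left (hsum.trans (le_of_eq ?_)) hn
    ring
  obtain ⟨K, hK⟩ := exists_circleAverage_sum_le hWd hW0 hφ hb (by positivity)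
    (fun r hr ↦ circleAverage_norm_sq_le _ hr.1.le hr.2) hdecay
  exact logIntegral_lt_top_of_circleAverage_le hφ hK

end WeightedComposition

/-! ### The equivalence -/

open WeightedComposition in
theorem mainTheorem4 (φ : 𝔻 → 𝔻) (hφ : IsSymbol φ) :
    List.TFAE [
      ∃ w : HardyTwo, w ≠ 0 ∧ WeightedCompMemSchatten 2 w φ,
      ∃ w : 𝔻 → ℂ, IsHardyInfty w ∧ w ≠ 0 ∧ ∀ p : ℝ, 0 < p → WeightedCompMemSchatten p w φ,
      ∃ p : ℝ, 0 < p ∧ ∃ w : 𝔻 → ℂ, IsHardyInfty w ∧ w ≠ 0 ∧ WeightedCompMemSchatten p w φ,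
      logIntegral φ < ∞] := by
  tfae_have 2 → 3 := by
    rintro ⟨w, hw, hw0, h⟩
    exact ⟨1, one_pos, w, hw, hw0, h 1 one_pos⟩
  tfae_have 3 → 4 := by
    rintro ⟨p, hp, w, -, hw0, h⟩
    exact logIntegral_lt_top_of_memSchatten hφ hw0 hp h
  tfae_have 4 → 2 := by
    intro h
    obtain ⟨w, hw, hw1, hw0, hk⟩ := exists_outer hφ h
    exact ⟨w, ⟨hw, 1, hw1⟩, fun h0 ↦ hw0 0 (congrFun h0 0),
      fun p hp ↦ memSchatten_of_le_pow hφ hw hk hp⟩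
  tfae_have 2 → 1 := by
    rintro ⟨w, ⟨hw, C, hC⟩, hw0, h⟩
    obtain ⟨f, hf, -⟩ := HardyTwo.exists_of_bounded hw
      ((norm_nonneg _).trans (hC 0)) hC
    have hfw : ⇑f = w := funext hf
    refine ⟨f, fun h0 ↦ hw0 ?_, ?_⟩
    · rw [← hfw, h0, RKHS.coe_zero]
    · rw [hfw]
      exact h 2 two_pos
  -- The necessity argument does not need a bounded weight, so the case of `w` in `H²` is its
  -- instance `p = 2`.
  tfae_have 1 → 4 := by
    rintro ⟨w, hw0, h⟩
    refine logIntegral_lt_top_of_memSchatten hφ (fun h0 ↦ hw0 ?_) two_pos h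
    exact RKHS.ext fun z ↦ by rw [h0, RKHS.coe_zero]
  tfae_finish
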